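/- **Theorem.** Let $n\ge1$, $m\ge 0$, and let $d-1\ge 0$ be the number of obstacles. Write $\mathcal B(a,r)$ and $\mathcal B^\circ(a,r)$ for closed and open Euclidean balls. *Plant.* Consider $\dot x=f(x)+g(x)u+\omega(t)$ in $\mathbb R^n$, where $f:\mathbb R^n\to\mathbb R^n$ and $g:\mathbb R^n\to\mathbb R^{n\times n}$ are bounded and locally Lipschitz, $\tfrac12(g(x)+g(x)^\top)$ is positive definite or negative definite for every $x$, and $\omega:[0,\infty)\to\mathbb R^n$ is bounded and piecewise continuous (on each bounded interval continuous off a finite set, with finite one-sided limits). Let $k\in\mathbb R$ be such that $k>0$ if $\tfrac12(g+g^\top)\succ0$ and $k<0$ if $\tfrac12(g+g^\top)\prec0$. *Task.* Let $t_f>0$. The unsafe set is $\mathcal U(t)=\bigcup_{j=1}^{d-1}\mathcal B^\circ(b_j(t),r_j)$ with $r_j>0$ and centers $b_j$ differentiable on $[0,t_f]$. The target set is $\mathcal R=\mathcal B(b_R,r_R)$. *Virtual dynamics and quadratic program.* Let $0<r_c<r_R$. Let $f_c:\mathbb R^n\to\mathbb R^n$ and $g_c:\mathbb R^n\to\mathbb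 R^{n\times m}$ be locally Lipschitz. Let $r_r(t)=-\mu\,t/t_f+q$ with $0\le r_r(t_f)\le r_R-r_c$. Put $$h_j(z,t)=\|z-b_j(t)\|^2-(r_j+r_c)^2\quad(1\le j\le d-1),\qquad h_d(z,t)=r_r(t)^2-\|z-b_R\|^2 .$$ Let $H\in\mathbb R^{m\times m}$ be symmetric positive definite, $F\in\mathbb R^m$, and let $\gamma_1,\dots,\gamma_d:\mathbb R\to\mathbb R$ be continuous and strictly increasing with $\gamma_j(0)=0$ and $\gamma_j(s)\to\infty$ as $s\to\infty$. For $(z,t)\in\mathbb R^n\times[0,t_f]$ consider the program $$\min_{v\in\mathbb R^m}\ \tfrac12v^\top Hv+F^\top v\quad\text{s.t.}\quad \tfrac{\partial h_j}{\partial z}(z,t)\,\big(f_c(z)+g_c(z)v\big)+\tfrac{\partial h_j}{\partial t}(z,t)+\gamma_j(h_j(z,t))\ge0\quad(1\le j\le d),$$ and let $u_c(z,t)$ be its minimizer whenever it is feasible. Let $c:[0,t_f]\to\mathbb R^n$ be a trajectory of $\dot c=f_c(c)+g_c(c)\,u_c(c,t)$: $c$ is continuous, the equation holds for all $t\in[0,t_f]$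 outside a finite set of switching times, and $c$ has one-sided derivatives at the switching times. Assume $\|c(0)-b_R\|\le r_r(0)$, $\mathcal B^\circ(c(0),r_c)\subset\mathbb R^n\setminus\mathcal U(0)$, and that the program at $(c(t),t)$ is feasible for every $t\in[0,t_f]$. *Confinement law.* With $e=x-c(t)$ and $\hat e=\|e\|/r_c$, let $$u=-k\,\ln\!\Big(\frac{1+\hat e}{1-\hat e}\Big)\frac{e}{\|e\|}\ \text{ if } e\neq0,\qquad u=0\ \text{ if } e=0 .$$ *Conclusion.* Let $x_0\in\mathcal B^\circ(c(0),r_c)$. Then the closed-loop system $\dot x=f(x)+g(x)u+\omega$, $x(0)=x_0$, has a solution $x$ on $[0,t_f]$ (continuous, satisfying the equation at all but finitely many times), every solution of it on an interval $[0,T)$ with $0<T\le t_f$ is the restriction of $x$, and $$x(t)\in\mathcal B^\circ(c(t),r_c)\ \text{ and }\ x(t)\notin\mathcal U(t)\ \text{ for all }t\in[0,t_f],\qquad x(t_f)\in\mathcal R .$$ -/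

import Mathlib

open Set Filter Topology
open scoped Matrix Matrix.Norms.L2Operator

noncomputable section

namespace VCZ

/-- `ℝⁿ` with the Euclidean norm. -/
abbrev Vec (n : ℕ) : Type := EuclideanSpace ℝ (Fin n)

/-! ### The plant `ẋ = f(x) + g(x) u + ω(t)` -/

/-- The symmetric part `(A + Aᵀ) / 2`. -/
def symPart {n : ℕ} (A : Matrix (Fin n) (Fin n) ℝ) : Matrix (Fin n) (Fin n) ℝ :=
  (1 / 2 : ℝ) • (A + Aᵀ)

/-- Piecewise continuity on `[a, b]`: continuous off a finite set of times, with finite one-sided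
limits at the exceptional times. -/
def PiecewiseContinuousOn {n : ℕ} (w : ℝ → Vec n) (a b : ℝ) : Prop :=
  ∃ S : Finset ℝ,
    (∀ t ∈ Icc a b, t ∉ S → ContinuousWithinAt w (Icc a b) t) ∧
    (∀ t ∈ Ioc a b, ∃ l, Tendsto w (𝓝[<] t) (𝓝 l)) ∧
    (∀ t ∈ Ico a b, ∃ l, Tendsto w (𝓝[>] t) (𝓝 l))

/-- Standing assumptions on the plant. Matrices carry the operator norm of the Euclidean norm. -/
structure PlantAssumption {n : ℕ} (f : Vec n → Vec n) (g : Vec n → Matrix (Fin n) (Fin n) ℝ)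
    (ω : ℝ → Vec n) : Prop where
  f_bounded : ∃ C : ℝ, ∀ x, ‖f x‖ ≤ C
  f_lipschitz : LocallyLipschitz f
  g_bounded : ∃ C : ℝ, ∀ x, ‖g x‖ ≤ C
  g_lipschitz : LocallyLipschitz g
  g_sign_definite : ∀ x, (symPart (g x)).PosDef ∨ (-symPart (g x)).PosDef
  ω_bounded : ∃ C : ℝ, ∀ t, 0 ≤ t → ‖ω t‖ ≤ C
  ω_piecewise : ∀ T : ℝ, 0 < T → PiecewiseContinuousOn ω 0 T

/-- The sign rule for the gain: positive if the symmetric part of `g` is positive definite, negative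
if it is negative definite. -/
def GainSign {n : ℕ} (g : Vec n → Matrix (Fin n) (Fin n) ℝ) (k : ℝ) : Prop :=
  (∀ x, (symPart (g x)).PosDef → 0 < k) ∧ (∀ x, (-symPart (g x)).PosDef → k < 0)

/-! ### The confinement law -/

/-- The logarithmic barrier `ζ(s) = ln ((1 + s) / (1 - s))`, meaningful for `0 ≤ s < 1`. -/
def zeta (s : ℝ) : ℝ := Real.log ((1 + s) / (1 - s))

/-- `u = -k ζ(‖e‖ / r_c) e / ‖e‖` if `e ≠ 0`, and `u = 0` if `e = 0`. -/
def confinementLaw {n : ℕ} (k rc : ℝ) (e : Vec n) : Vec n :=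
  if 0 < ‖e‖ then -((k * zeta (‖e‖ / rc)) • ((1 / ‖e‖) • e)) else 0

/-- `x` is a solution, on the interval `I`, of the plant under the confinement law around the moving
center `c`: continuous, and satisfying the differential equation at all but finitely many times. -/
def IsClosedLoopSolution {n : ℕ} (f : Vec n → Vec n) (g : Vec n → Matrix (Fin n) (Fin n) ℝ)
    (ω : ℝ → Vec n) (k rc : ℝ) (c : ℝ → Vec n) (I : Set ℝ) (x : ℝ → Vec n) : Prop :=
  ContinuousOn x I ∧
    ∃ S : Finset ℝ, ∀ t ∈ I, t ∉ S →
      HasDerivWithinAt x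
        (f (x t) + Matrix.toEuclideanLin (g (x t)) (confinementLaw k rc (x t - c t)) + ω t) I t

/-! ### The task, the virtual dynamics and the quadratic program -/

/-- Extended class `𝒦_∞` functions on `ℝ`. -/
structure IsExtendedKInfty (α : ℝ → ℝ) : Prop where
  continuous : Continuous α
  strictMono : StrictMono α
  map_zero : α 0 = 0
  unbounded : Tendsto α atTop atTop

/-- The data of a prescribed-time reach-avoid task with `N` obstacles, together with the choices
of the designer: virtual dynamics with state in `ℝⁿ` and input in `ℝᵖ`, radius of the zone,
shrinking radius, and quadratic program. -/
structure Design (n p N : ℕ) where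
  /-- prescribed time -/
  tf : ℝ
  /-- obstacle centers -/
  bu : Fin N → ℝ → Vec n
  /-- obstacle radii -/
  ru : Fin N → ℝ
  /-- center of the target -/
  bR : Vec n
  /-- radius of the target -/
  rR : ℝ
  /-- radius of the virtual confinement zone -/
  rc : ℝ
  /-- slope parameter of the shrinking radius -/
  slope : ℝ
  /-- initial value of the shrinking radius -/
  start : ℝ
  /-- drift of the virtual dynamics -/
  fc : Vec n → Vec n
  /-- input matrix of the virtual dynamics -/
  gc : Vec n → Matrix (Fin n) (Fin p) ℝ
  /-- quadratic part of the cost -/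
  H : Matrix (Fin p) (Fin p) ℝ
  /-- linear part of the cost -/
  F : Fin p → ℝ
  /-- the functions `γ_j`; the last index belongs to the target barrier -/
  γ : Fin (N + 1) → ℝ → ℝ

namespace Design

variable {n p N : ℕ}

/-- The unsafe set `𝒰(t)`, a union of open balls. -/
def unsafeSet (D : Design n p N) (t : ℝ) : Set (Vec n) :=
  ⋃ j : Fin N, Metric.ball (D.bu j t) (D.ru j)

/-- The target set `ℛ`. -/
def target (D : Design n p N) : Set (Vec n) := Metric.closedBall D.bR D.rR

/-- The shrinking radius `r_r(t) = -m t / t_f + q`. -/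
def shrinkRadius (D : Design n p N) (t : ℝ) : ℝ := -D.slope * (t / D.tf) + D.start

/-- The barrier functions: `‖z - b_j(t)‖² - (r_j + r_c)²` for the obstacles, followed by
`r_r(t)² - ‖z - b_R‖²` for the target. -/
def barrier (D : Design n p N) : Fin (N + 1) → Vec n → ℝ → ℝ :=
  Fin.snoc (α := fun _ => Vec n → ℝ → ℝ)
    (fun j z t => ‖z - D.bu j t‖ ^ 2 - (D.ru j + D.rc) ^ 2)
    (fun z t => D.shrinkRadius t ^ 2 - ‖z - D.bR‖ ^ 2)

/-- Right-hand side `f_c(z) + g_c(z) u` of the virtual dynamics. -/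
def virtualField (D : Design n p N) (z : Vec n) (u : Vec p) : Vec n :=
  D.fc z + Matrix.toEuclideanLin (D.gc z) u

/-- The inputs that satisfy all the barrier constraints at `(z, t)`:
`∂h_j/∂z (f_c + g_c u) + ∂h_j/∂t + γ_j(h_j) ≥ 0`. At the end points of `[0, t_f]` the time
derivative is one-sided. -/
def feasibleInputs (D : Design n p N) (z : Vec n) (t : ℝ) : Set (Vec p) :=
  {u | ∀ j : Fin (N + 1),
    0 ≤ fderiv ℝ (fun y => D.barrier j y t) z (D.virtualField z u)
      + derivWithin (fun s => D.barrier j z s) (Icc 0 D.tf) t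
      + D.γ j (D.barrier j z t)}

/-- The cost `½ uᵀ H u + Fᵀ u`. -/
def cost (D : Design n p N) (u : Vec p) : ℝ :=
  1 / 2 * (u.ofLp ⬝ᵥ (D.H *ᵥ u.ofLp)) + D.F ⬝ᵥ u.ofLp

/-- `u` solves the quadratic program at `(z, t)`. -/
def IsOptimal (D : Design n p N) (z : Vec n) (t : ℝ) (u : Vec p) : Prop :=
  u ∈ D.feasibleInputs z t ∧ ∀ v ∈ D.feasibleInputs z t, D.cost u ≤ D.cost v

open Classical in
/-- The virtual control: the solution of the quadratic program (and `0` where there is none). -/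
def virtualControl (D : Design n p N) (z : Vec n) (t : ℝ) : Vec p :=
  if h : ∃ u, D.IsOptimal z t u then h.choose else 0

/-- `c` is a trajectory of the virtual dynamics on `[0, t_f]` driven by the quadratic program:
continuous, satisfying the differential equation off a finite set of switching times, and with
one-sided derivatives at the switching times. -/
def IsVirtualTrajectory (D : Design n p N) (c : ℝ → Vec n) : Prop :=
  ContinuousOn c (Icc 0 D.tf) ∧
    ∃ S : Finset ℝ,
      (∀ t ∈ Icc 0 D.tf, t ∉ S →
        HasDerivWithinAt c (D.virtualField (c t) (D.virtualControl (c t) t)) (Icc 0 D.tf) t) ∧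
      (∀ t ∈ Icc 0 D.tf, t ∈ S →
        (∃ v, HasDerivWithinAt c v (Icc 0 t) t) ∧ (∃ v, HasDerivWithinAt c v (Icc t D.tf) t))

/-- The requirements on the task and on the designer's choices, for an initial center `c₀`. -/
structure Admissible (D : Design n p N) (c₀ : Vec n) : Prop where
  tf_pos : 0 < D.tf
  ru_pos : ∀ j, 0 < D.ru j
  bu_differentiable : ∀ j, DifferentiableOn ℝ (D.bu j) (Icc 0 D.tf)
  rc_pos : 0 < D.rc
  rc_lt_rR : D.rc < D.rR
  start_le : ‖c₀ - D.bR‖ ≤ D.shrinkRadius 0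
  final_nonneg : 0 ≤ D.shrinkRadius D.tf
  final_le : D.shrinkRadius D.tf ≤ D.rR - D.rc
  fc_lipschitz : LocallyLipschitz D.fc
  gc_lipschitz : LocallyLipschitz D.gc
  H_posDef : D.H.PosDef
  γ_class : ∀ j, IsExtendedKInfty (D.γ j)

/-- The prescribed-time reach-avoid task. -/
def ReachAvoid (D : Design n p N) (x : ℝ → Vec n) : Prop :=
  (∀ t ∈ Icc 0 D.tf, x t ∈ (D.unsafeSet t)ᶜ) ∧ x D.tf ∈ D.target

end Design

end VCZ

end

namespace VCZ

/-! ### Calculus off a finite set -/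

/-! The argument has two independent halves. On the virtual side, the j-th constraint of the program
says that h_j(c(t), t) has derivative at least -γ_j(h_j), and γ_j is negative on the negative half
line, so h_j cannot become negative (`barrier_nonneg`). Hence the ball of radius r_c around c(t)
misses every obstacle and lies in the target at t_f; it remains to keep x in that ball
(`reachAvoid_of_confined`).

On the plant side the law is singular at the boundary of the zone. Freezing the logarithm above a
level σ < 1 gives a bounded, locally Lipschitz field, so that Picard–Lindelöf yields a solution on
all of [0, t_f] (`exists_solvesOff`), and this solves the true equation as long as ‖e‖ ≤ σ r_c. A
continuity argument in the final time (`exists_confined`) shows that a single σ serves the whole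
interval; the only obstruction would be ‖e‖ approaching r_c as t tends to some T from the left,
which `exists_margin` excludes.

That lemma is the crux. No bound on the velocity of c is available, so ‖x - c(t)‖² is not
differentiated; the distance to the frozen point c(T) is used instead. The left derivative of c at T
gives ‖c(t) - c(T)‖ ≤ L (T - t) near T, and close enough to the boundary the logarithmic push beats
f, ω and the rate L. Uniqueness (`eqOn_of_confined`) follows because a confined solution on a
compact interval keeps a gap from the boundary, hence solves a saturated equation. -/

theorem sub_le_mul_sub_of_deriv_le_off_finset (S : Finset ℝ) {φ φ' : ℝ → ℝ} {M : ℝ} {a b : ℝ}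
    (hab : a ≤ b) (hc : ContinuousOn φ (Icc a b))
    (hd : ∀ t ∈ Ioo a b, t ∉ S → HasDerivAt φ (φ' t) t)
    (hM : ∀ t ∈ Ioo a b, t ∉ S → φ' t ≤ M) : φ b - φ a ≤ M * (b - a) := by
  induction S using Finset.induction_on generalizing a b with
  | empty =>
    refine Convex.image_sub_le_mul_sub_of_deriv_le (convex_Icc a b) hc ?_ ?_ a
      (left_mem_Icc.2 hab) b (right_mem_Icc.2 hab) hab
    · rw [interior_Icc]
      exact fun t ht => (hd t ht (by simp)).differentiableAt.differentiableWithinAt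
    · rw [interior_Icc]
      intro t ht
      rw [(hd t ht (by simp)).deriv]
      exact hM t ht (by simp)
  | insert s S hs ih =>
    by_cases hsab : s ∈ Ioo a b
    · have h1 := ih (b := s) hsab.1.le (hc.mono (Icc_subset_Icc_right hsab.2.le))
        (fun t ht htS => hd t ⟨ht.1, ht.2.trans hsab.2⟩ (by simp [htS, ht.2.ne]))
        (fun t ht htS => hM t ⟨ht.1, ht.2.trans hsab.2⟩ (by simp [htS, ht.2.ne]))
      have h2 := ih (a := s) hsab.2.le (hc.mono (Icc_subset_Icc_left hsab.1.le))
        (fun t ht htS => hd t ⟨hsab.1.trans ht.1, ht.2⟩ (by simp [htS, ht.1.ne']))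
        (fun t ht htS => hM t ⟨hsab.1.trans ht.1, ht.2⟩ (by simp [htS, ht.1.ne']))
      linarith
    · have hne : ∀ t ∈ Ioo a b, t ≠ s := fun t ht h => hsab (h ▸ ht)
      exact ih hab hc (fun t ht htS => hd t ht (by simp [htS, hne t ht]))
        (fun t ht htS => hM t ht (by simp [htS, hne t ht]))

/-- If `h' ≥ -γ(h)` off a finite set, where `γ ≤ 0` on the negative half line, then `h` stays
nonnegative. -/
theorem nonneg_of_neg_comp_le_deriv_off_finset (S : Finset ℝ) {h h' γ : ℝ → ℝ} {a b : ℝ}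
    (hc : ContinuousOn h (Icc a b)) (h0 : 0 ≤ h a)
    (hd : ∀ t ∈ Ioo a b, t ∉ S → HasDerivAt h (h' t) t)
    (hγ : ∀ s < 0, γ s ≤ 0)
    (hle : ∀ t ∈ Ioo a b, t ∉ S → 0 ≤ h' t + γ (h t)) :
    ∀ t ∈ Icc a b, 0 ≤ h t := by
  intro t₁ ht₁
  by_contra! hneg
  have hsub : Icc a t₁ ⊆ Icc a b := Icc_subset_Icc_right ht₁.2
  -- t₀ is the last time before t₁ with h ≥ 0. After it h < 0, so γ(h) ≤ 0 forces h' ≥ 0 and h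
  -- cannot have dropped.
  obtain ⟨t₀, ht₀, hmax⟩ := IsCompact.exists_isGreatest (s := Icc a t₁ ∩ h ⁻¹' Ici 0)
    (isCompact_Icc.of_isClosed_subset
      ((hc.mono hsub).preimage_isClosed_of_isClosed isClosed_Icc isClosed_Ici) inter_subset_left)
    ⟨a, left_mem_Icc.2 ht₁.1, h0⟩
  have hlt : ∀ t ∈ Ioo t₀ t₁, h t < 0 := by
    intro t ht
    by_contra! hh
    exact absurd (hmax ⟨⟨ht₀.1.1.trans ht.1.le, ht.2.le⟩, hh⟩) (not_le.2 ht.1)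
  have hIoo : ∀ t ∈ Ioo t₀ t₁, t ∈ Ioo a b :=
    fun t ht => ⟨ht₀.1.1.trans_lt ht.1, ht.2.trans_le ht₁.2⟩
  have := sub_le_mul_sub_of_deriv_le_off_finset S (φ := fun t => -h t) (φ' := fun t => -h' t)
    (M := 0) ht₀.1.2 (hc.mono (Icc_subset_Icc ht₀.1.1 ht₁.2)).neg
    (fun t ht htS => (hd t (hIoo t ht) htS).neg)
    (fun t ht htS => by
      have h1 := hle t (hIoo t ht) htS
      have h2 := hγ _ (hlt t ht)
      linarith)
  have h3 : 0 ≤ h t₀ := ht₀.2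
  linarith

variable {E : Type*} [NormedAddCommGroup E] [InnerProductSpace ℝ E]

/-- `x` solves `x' = F(t, x)` on `[a, b]`, except at the interior times in `S`. -/
def SolvesOff (S : Finset ℝ) (F : ℝ → E → E) (a b : ℝ) (x : ℝ → E) : Prop :=
  ContinuousOn x (Icc a b) ∧ ∀ t ∈ Ioo a b, t ∉ S → HasDerivAt x (F t (x t)) t

theorem SolvesOff.mono {S S' : Finset ℝ} {F : ℝ → E → E} {a b a' b' : ℝ} {x : ℝ → E}
    (h : SolvesOff S F a b x) (hS : S ⊆ S') (ha : a ≤ a') (hb : b' ≤ b) :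
    SolvesOff S' F a' b' x :=
  ⟨h.1.mono (Icc_subset_Icc ha hb), fun t ht htS =>
    h.2 t ⟨ha.trans_lt ht.1, ht.2.trans_le hb⟩ fun h' => htS (hS h')⟩

theorem SolvesOff.congr_field {S : Finset ℝ} {F F' : ℝ → E → E} {a b : ℝ} {x : ℝ → E}
    (h : SolvesOff S F a b x) (hF : ∀ t ∈ Ioo a b, F t (x t) = F' t (x t)) :
    SolvesOff S F' a b x :=
  ⟨h.1, fun t ht htS => hF t ht ▸ h.2 t ht htS⟩

/-- Uniqueness for differential equations whose solutions may have finitely many corners. -/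
theorem SolvesOff.eqOn {S : Finset ℝ} {F : ℝ → E → E} {a b K : ℝ} {x y : ℝ → E} {s : Set E}
    (hx : SolvesOff S F a b x) (hy : SolvesOff S F a b y) (hxy : x a = y a)
    (hxs : ∀ t ∈ Icc a b, x t ∈ s) (hys : ∀ t ∈ Icc a b, y t ∈ s)
    (hF : ∀ t ∈ Icc a b, ∀ v ∈ s, ∀ w ∈ s, ‖F t v - F t w‖ ≤ K * ‖v - w‖) :
    EqOn x y (Icc a b) := by
  intro t ht
  have hsub : Icc a t ⊆ Icc a b := Icc_subset_Icc_right ht.2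
  have hIoo : ∀ r ∈ Ioo a t, r ∈ Ioo a b := fun r hr => ⟨hr.1, hr.2.trans_le ht.2⟩
  -- Grönwall by an integrating factor: exp(-2Kr) ‖x - y‖² is nonincreasing and starts at 0.
  have key := sub_le_mul_sub_of_deriv_le_off_finset S
    (φ := fun r => ‖x r - y r‖ ^ 2 * Real.exp (-(2 * K) * r))
    (φ' := fun r => 2 * inner ℝ (x r - y r) (F r (x r) - F r (y r)) * Real.exp (-(2 * K) * r)
      + ‖x r - y r‖ ^ 2 * (Real.exp (-(2 * K) * r) * (-(2 * K)))) (M := 0) ht.1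
    ((((hx.1.mono hsub).sub (hy.1.mono hsub)).norm.pow 2).mul (by fun_prop))
    (fun r hr hrS => by
      have h1 := ((hx.2 r (hIoo r hr) hrS).sub (hy.2 r (hIoo r hr) hrS)).norm_sq
      have h2 : HasDerivAt (fun r => Real.exp (-(2 * K) * r))
          (Real.exp (-(2 * K) * r) * (-(2 * K))) r := by
        simpa using ((hasDerivAt_id r).const_mul (-(2 * K))).exp
      exact h1.mul h2)
    (fun r hr _ => by
      have hr' := Ioo_subset_Icc_self (hIoo r hr)
      have h1 := hF r hr' _ (hxs r hr') _ (hys r hr')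
      have h2 := real_inner_le_norm (x r - y r) (F r (x r) - F r (y r))
      have h3 : inner ℝ (x r - y r) (F r (x r) - F r (y r)) ≤ K * ‖x r - y r‖ ^ 2 :=
        h2.trans ((mul_le_mul_of_nonneg_left h1 (norm_nonneg _)).trans_eq (by ring))
      have h4 := mul_le_mul_of_nonneg_right h3 (Real.exp_pos (-(2 * K) * r)).le
      linarith)
  simp only [hxy, sub_self, norm_zero] at key
  have h5 : ‖x t - y t‖ ^ 2 * Real.exp (-(2 * K) * t) ≤ 0 := by simpa using key
  have h6 : ‖x t - y t‖ ^ 2 ≤ 0 := nonpos_of_mul_nonpos_left h5 (Real.exp_pos _)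
  have h7 : ‖x t - y t‖ = 0 := by
    have := sq_nonneg ‖x t - y t‖
    exact pow_eq_zero_iff (two_ne_zero) |>.1 (le_antisymm h6 this)
  exact sub_eq_zero.1 (norm_eq_zero.1 h7)

/-! ### The barrier and the saturated law -/

theorem zeta_zero : zeta 0 = 0 := by simp [zeta]

theorem zeta_eq_sub {s : ℝ} (h0 : 0 ≤ s) (h1 : s < 1) :
    zeta s = Real.log (1 + s) - Real.log (1 - s) :=
  Real.log_div (by linarith) (by linarith)

theorem log_sub_log_le {u v : ℝ} (hu : 0 < u) (hv : 0 < v) :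
    Real.log u - Real.log v ≤ (u - v) / v := by
  rw [← Real.log_div hu.ne' hv.ne']
  refine (Real.log_le_sub_one_of_pos (div_pos hu hv)).trans_eq ?_
  field_simp

theorem zeta_mono {s t : ℝ} (h0 : 0 ≤ s) (hst : s ≤ t) (h1 : t < 1) : zeta s ≤ zeta t := by
  rw [zeta_eq_sub h0 (hst.trans_lt h1), zeta_eq_sub (h0.trans hst) h1]
  have := Real.log_le_log (by linarith : 0 < 1 + s) (by linarith : 1 + s ≤ 1 + t)
  have := Real.log_le_log (by linarith : 0 < 1 - t) (by linarith : 1 - t ≤ 1 - s)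
  linarith

theorem zeta_nonneg {s : ℝ} (h0 : 0 ≤ s) (h1 : s < 1) : 0 ≤ zeta s :=
  zeta_zero ▸ zeta_mono le_rfl h0 h1

/-- By log q ≤ q - 1, each of the two logarithms contributes slope at most 1 / (1 - σ). The constant
blows up as σ → 1, which is why the law has to be saturated strictly below 1. -/
theorem zeta_sub_le {s t σ : ℝ} (h0 : 0 ≤ s) (hst : s ≤ t) (htσ : t ≤ σ) (h1 : σ < 1) :
    zeta t - zeta s ≤ 2 / (1 - σ) * (t - s) := by
  rw [zeta_eq_sub h0 (by linarith), zeta_eq_sub (h0.trans hst) (by linarith)]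
  have e1 := log_sub_log_le (by linarith : 0 < 1 + t) (by linarith : 0 < 1 + s)
  have e2 := log_sub_log_le (by linarith : 0 < 1 - s) (by linarith : 0 < 1 - t)
  have e3 : (1 + t - (1 + s)) / (1 + s) ≤ (t - s) / (1 - σ) := by
    rw [show 1 + t - (1 + s) = t - s by ring]
    gcongr
    linarith
  have e4 : (1 - s - (1 - t)) / (1 - t) ≤ (t - s) / (1 - σ) := by
    rw [show 1 - s - (1 - t) = t - s by ring]
    gcongr
  have e5 : 2 / (1 - σ) * (t - s) = (t - s) / (1 - σ) + (t - s) / (1 - σ) := by ring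
  linarith

theorem tendsto_zeta : Tendsto zeta (𝓝[<] 1) atTop := by
  refine Real.tendsto_log_atTop.comp ?_
  have h1 : Tendsto (fun s : ℝ => 1 + s) (𝓝[<] 1) (𝓝 2) := by
    have : Tendsto (fun s : ℝ => 1 + s) (𝓝 1) (𝓝 (1 + 1)) := by
      exact (continuous_const.add continuous_id).tendsto _
    norm_num at this
    exact this.mono_left nhdsWithin_le_nhds
  have h2 : Tendsto (fun s : ℝ => 1 - s) (𝓝[<] 1) (𝓝[>] 0) := by
    refine tendsto_nhdsWithin_iff.2 ⟨?_, ?_⟩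
    · have : Tendsto (fun s : ℝ => 1 - s) (𝓝 1) (𝓝 (1 - 1)) :=
        (continuous_const.sub continuous_id).tendsto _
      rw [sub_self] at this
      exact this.mono_left nhdsWithin_le_nhds
    · filter_upwards [self_mem_nhdsWithin] with s hs
      exact sub_pos.2 (mem_Iio.1 hs)
  exact h1.pos_mul_atTop two_pos (tendsto_inv_nhdsGT_zero.comp h2)

/-- The barrier frozen above the level `σ`. -/
noncomputable def satZeta (σ s : ℝ) : ℝ := zeta (min s σ)

theorem satZeta_of_le {σ s : ℝ} (h : s ≤ σ) : satZeta σ s = zeta s := by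
  rw [satZeta, min_eq_left h]

theorem satZeta_nonneg {σ s : ℝ} (hσ0 : 0 ≤ σ) (hσ : σ < 1) (hs : 0 ≤ s) : 0 ≤ satZeta σ s :=
  zeta_nonneg (le_min hs hσ0) ((min_le_right _ _).trans_lt hσ)

theorem satZeta_le {σ s : ℝ} (hσ0 : 0 ≤ σ) (hσ : σ < 1) (hs : 0 ≤ s) :
    satZeta σ s ≤ zeta σ :=
  zeta_mono (le_min hs hσ0) (min_le_right _ _) hσ

theorem abs_satZeta_sub_le {σ s t : ℝ} (hσ0 : 0 ≤ σ) (hσ : σ < 1) (hs : 0 ≤ s) (ht : 0 ≤ t) :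
    |satZeta σ t - satZeta σ s| ≤ 2 / (1 - σ) * |t - s| := by
  wlog hst : s ≤ t generalizing s t
  · rw [abs_sub_comm, abs_sub_comm t]
    exact this ht hs (le_of_not_ge hst)
  have hm : min s σ ≤ min t σ := min_le_min_right _ hst
  have hL : 0 ≤ 2 / (1 - σ) := div_nonneg zero_le_two (by linarith)
  unfold satZeta
  rw [abs_of_nonneg (sub_nonneg.2 (zeta_mono (le_min hs hσ0) hm
    ((min_le_right _ _).trans_lt hσ))), abs_of_nonneg (sub_nonneg.2 hst)]
  refine (zeta_sub_le (le_min hs hσ0) hm (min_le_right _ _) hσ).trans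
    (mul_le_mul_of_nonneg_left ?_ hL)
  have := abs_min_sub_min_le_max t σ s σ
  rw [sub_self, abs_zero, max_eq_left (abs_nonneg _), abs_of_nonneg (sub_nonneg.2 hst)] at this
  exact (le_abs_self _).trans this

/-- A radial map whose profile is Lipschitz and vanishes at `0` is Lipschitz. -/
theorem norm_radial_sub_le {h : ℝ → ℝ} {L : ℝ} (h0 : h 0 = 0)
    (hL : ∀ s t, 0 ≤ s → 0 ≤ t → |h t - h s| ≤ L * |t - s|) (a b : E) :
    ‖h ‖a‖ • ((1 / ‖a‖) • a) - h ‖b‖ • ((1 / ‖b‖) • b)‖ ≤ 3 * L * ‖a - b‖ := by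
  wlog hab : ‖b‖ ≤ ‖a‖ generalizing a b
  · rw [norm_sub_rev, norm_sub_rev a]
    exact this b a (le_of_not_ge hab)
  have hL0 : 0 ≤ L := by
    have := (abs_nonneg _).trans (hL 0 1 le_rfl zero_le_one)
    simpa using this
  rcases eq_or_ne a 0 with rfl | ha
  · have hb : b = 0 := norm_le_zero_iff.1 (by simpa using hab)
    simp [hb]
  have ha' : 0 < ‖a‖ := norm_pos_iff.2 ha
  have hbb : |h ‖b‖| ≤ L * ‖b‖ := by
    have := hL 0 ‖b‖ le_rfl (norm_nonneg _)
    rwa [h0, sub_zero, sub_zero, abs_of_nonneg (norm_nonneg b)] at this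
  have hunit : ‖(1 / ‖a‖) • a‖ = 1 := by
    rw [norm_smul, norm_div, norm_one, norm_norm, one_div_mul_cancel ha'.ne']
  -- The first summand costs L. In the second, |h ‖b‖| ≤ L ‖b‖, and the factor ‖b‖ tames the
  -- difference of directions, at cost 2L; together 3L.
  have hsplit : h ‖a‖ • ((1 / ‖a‖) • a) - h ‖b‖ • ((1 / ‖b‖) • b)
      = (h ‖a‖ - h ‖b‖) • ((1 / ‖a‖) • a) + h ‖b‖ • ((1 / ‖a‖) • a - (1 / ‖b‖) • b) := by
    module
  have hd : |‖a‖ - ‖b‖| ≤ ‖a - b‖ := abs_norm_sub_norm_le a b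
  have h1 : ‖(h ‖a‖ - h ‖b‖) • ((1 / ‖a‖) • a)‖ ≤ L * ‖a - b‖ := by
    rw [norm_smul, hunit, mul_one, Real.norm_eq_abs]
    exact (hL _ _ (norm_nonneg _) (norm_nonneg _)).trans (mul_le_mul_of_nonneg_left hd hL0)
  have h2 : ‖b‖ * ‖(1 / ‖a‖) • a - (1 / ‖b‖) • b‖ ≤ 2 * ‖a - b‖ := by
    rcases eq_or_ne b 0 with rfl | hb
    · simp
    have hb' : 0 < ‖b‖ := norm_pos_iff.2 hb
    have : ‖b‖ * ‖(1 / ‖a‖) • a - (1 / ‖b‖) • b‖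
        = ‖(a - b) + (‖b‖ - ‖a‖) • ((1 / ‖a‖) • a)‖ := by
      rw [← abs_of_nonneg (norm_nonneg b), ← Real.norm_eq_abs, ← norm_smul,
        Real.norm_eq_abs, abs_of_nonneg (norm_nonneg b)]
      congr 1
      rw [smul_sub, sub_smul, smul_smul ‖b‖ (1 / ‖b‖), mul_one_div_cancel hb'.ne', one_smul,
        smul_smul ‖a‖ (1 / ‖a‖), mul_one_div_cancel ha'.ne', one_smul]
      abel
    rw [this]
    refine (norm_add_le _ _).trans ?_
    rw [norm_smul, hunit, mul_one, Real.norm_eq_abs, abs_sub_comm]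
    linarith
  have h3 : ‖h ‖b‖ • ((1 / ‖a‖) • a - (1 / ‖b‖) • b)‖ ≤ L * (2 * ‖a - b‖) := by
    rw [norm_smul, Real.norm_eq_abs]
    calc _ ≤ L * ‖b‖ * ‖(1 / ‖a‖) • a - (1 / ‖b‖) • b‖ := by gcongr
      _ = L * (‖b‖ * ‖(1 / ‖a‖) • a - (1 / ‖b‖) • b‖) := by ring
      _ ≤ _ := by gcongr
  rw [hsplit]
  refine (norm_add_le _ _).trans ?_
  linarith

/-- The confinement law with the barrier `z` in place of the logarithmic one. -/
noncomputable def radialLaw (z : ℝ → ℝ) (k rc : ℝ) (e : E) : E :=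
  -((k * z (‖e‖ / rc)) • ((1 / ‖e‖) • e))

/-- The case distinction is redundant: the radial formula is a multiple of e, hence already 0 at e =
0. -/
theorem confinementLaw_eq {n : ℕ} (k rc : ℝ) (e : Vec n) :
    confinementLaw k rc e = radialLaw zeta k rc e := by
  unfold confinementLaw radialLaw
  split_ifs with h
  · rfl
  · have : e = 0 := norm_le_zero_iff.1 (not_lt.1 h)
    simp [this]

theorem radialLaw_satZeta_of_le {k rc σ : ℝ} {e : E} (h : ‖e‖ / rc ≤ σ) :
    radialLaw (satZeta σ) k rc e = radialLaw zeta k rc e := by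
  rw [radialLaw, radialLaw, satZeta_of_le h]

theorem norm_radialLaw_le (z : ℝ → ℝ) (k rc : ℝ) (e : E) :
    ‖radialLaw z k rc e‖ ≤ |k| * |z (‖e‖ / rc)| := by
  rw [radialLaw, norm_neg, norm_smul, norm_smul, norm_mul, Real.norm_eq_abs, Real.norm_eq_abs]
  refine mul_le_of_le_one_right (by positivity) ?_
  rw [norm_div, norm_one, norm_norm, one_div]
  exact inv_mul_le_one

theorem norm_radialLaw_satZeta_le {k rc σ : ℝ} (hrc : 0 < rc) (hσ0 : 0 ≤ σ) (hσ : σ < 1) (e : E) :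
    ‖radialLaw (satZeta σ) k rc e‖ ≤ |k| * zeta σ := by
  refine (norm_radialLaw_le _ _ _ _).trans (mul_le_mul_of_nonneg_left ?_ (abs_nonneg _))
  have hs : 0 ≤ ‖e‖ / rc := by positivity
  rw [abs_of_nonneg (satZeta_nonneg hσ0 hσ hs)]
  exact satZeta_le hσ0 hσ hs

theorem exists_norm_radialLaw_satZeta_sub_le (k : ℝ) {rc σ : ℝ} (hrc : 0 < rc) (hσ0 : 0 ≤ σ)
    (hσ : σ < 1) : ∃ L, 0 ≤ L ∧ ∀ a b : E,
      ‖radialLaw (satZeta σ) k rc a - radialLaw (satZeta σ) k rc b‖ ≤ L * ‖a - b‖ := by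
  have hσ' : 0 < 1 - σ := by linarith
  refine ⟨3 * (|k| * (2 / (1 - σ)) / rc), by positivity, fun a b => ?_⟩
  have := norm_radial_sub_le (E := E) (h := fun s => k * satZeta σ (s / rc))
    (L := |k| * (2 / (1 - σ)) / rc) (by simp [satZeta, min_eq_left hσ0, zeta_zero])
    (fun s t hs ht => by
      rw [← mul_sub, abs_mul]
      have h1 := abs_satZeta_sub_le hσ0 hσ (div_nonneg hs hrc.le) (div_nonneg ht hrc.le)
      rw [← sub_div, abs_div, abs_of_pos hrc] at h1
      calc _ ≤ |k| * (2 / (1 - σ) * (|t - s| / rc)) := by gcongr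
        _ = _ := by ring) a b
  unfold radialLaw
  rwa [← norm_neg, neg_sub_neg, neg_sub]

end VCZ

namespace VCZ

/-! ### The saturated closed loop -/

theorem exists_lipschitz_closedBall {E F : Type*} [NormedAddCommGroup E]
    [ProperSpace E] [NormedAddCommGroup F] {f : E → F} (hf : LocallyLipschitz f) (R : ℝ) :
    ∃ K, 0 ≤ K ∧ ∀ v ∈ Metric.closedBall (0 : E) R, ∀ w ∈ Metric.closedBall (0 : E) R,
      ‖f v - f w‖ ≤ K * ‖v - w‖ := by
  obtain ⟨K, hK⟩ := hf.locallyLipschitzOn.exists_lipschitzOnWith_of_compact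
    (isCompact_closedBall (0 : E) R)
  exact ⟨K, K.2, fun v hv w hw => hK.norm_sub_le hv hw⟩

variable {E : Type*} [NormedAddCommGroup E] [InnerProductSpace ℝ E]

/-- A bounded, locally Lipschitz plant on `[0, τ]`, with disturbance continuous off `S`. -/
structure RegularPlant (f : E → E) (G : E → E →L[ℝ] E) (ω : ℝ → E) (S : Finset ℝ) (τ B : ℝ) :
    Prop where
  f_lipschitz : LocallyLipschitz f
  f_le : ∀ x, ‖f x‖ ≤ B
  G_lipschitz : LocallyLipschitz G
  G_le : ∀ x, ‖G x‖ ≤ B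
  ω_le : ∀ t ∈ Icc 0 τ, ‖ω t‖ ≤ B
  ω_continuousAt : ∀ t ∈ Ioo 0 τ, t ∉ S → ContinuousAt ω t

/-- Closed-loop vector field of the confinement law with barrier `z`. -/
noncomputable def loopField (f : E → E) (G : E → E →L[ℝ] E) (ω : ℝ → E) (k rc : ℝ) (c : ℝ → E)
    (z : ℝ → ℝ) (t : ℝ) (x : E) : E :=
  f x + G x (radialLaw z k rc (x - c t)) + ω t

theorem loopField_satZeta_of_le {f : E → E} {G : E → E →L[ℝ] E} {ω : ℝ → E} {k rc σ t : ℝ}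
    {c : ℝ → E} {x : E} (hrc : 0 < rc) (h : ‖x - c t‖ ≤ σ * rc) :
    loopField f G ω k rc c (satZeta σ) t x = loopField f G ω k rc c zeta t x := by
  rw [loopField, loopField, radialLaw_satZeta_of_le ((div_le_iff₀ hrc).2 h)]

section Loop

variable {f : E → E} {G : E → E →L[ℝ] E} {ω : ℝ → E} {S : Finset ℝ} {τ B : ℝ}
  {c : ℝ → E} {k rc σ : ℝ}

theorem RegularPlant.bound_nonneg (hP : RegularPlant f G ω S τ B) : 0 ≤ B :=
  (norm_nonneg _).trans (hP.f_le 0)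

/-- The constant is uniform in t: ω cancels in differences, and c only translates the argument of a
globally Lipschitz, bounded law. The product G u is handled by the usual splitting. -/
theorem RegularPlant.exists_lipschitz_loopField [ProperSpace E] (hP : RegularPlant f G ω S τ B)
    (k : ℝ) (c : ℝ → E) (hrc : 0 < rc) (hσ0 : 0 ≤ σ) (hσ : σ < 1) (R : ℝ) :
    ∃ K, 0 ≤ K ∧ ∀ t, ∀ v ∈ Metric.closedBall (0 : E) R, ∀ w ∈ Metric.closedBall (0 : E) R,
      ‖loopField f G ω k rc c (satZeta σ) t v - loopField f G ω k rc c (satZeta σ) t w‖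
        ≤ K * ‖v - w‖ := by
  obtain ⟨Kf, hKf0, hKf⟩ := exists_lipschitz_closedBall hP.f_lipschitz R
  obtain ⟨KG, hKG0, hKG⟩ := exists_lipschitz_closedBall hP.G_lipschitz R
  obtain ⟨L, hL0, hL⟩ := exists_norm_radialLaw_satZeta_sub_le (E := E) k hrc hσ0 hσ
  have hB := hP.bound_nonneg
  have hζ := zeta_nonneg hσ0 hσ
  refine ⟨Kf + (KG * (|k| * zeta σ) + B * L), by positivity, fun t v hv w hw => ?_⟩
  set u := radialLaw (satZeta σ) k rc (v - c t) with hu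
  set u' := radialLaw (satZeta σ) k rc (w - c t) with hu'
  have e1 : loopField f G ω k rc c (satZeta σ) t v - loopField f G ω k rc c (satZeta σ) t w
      = (f v - f w) + ((G v - G w) u + G w (u - u')) := by
    rw [loopField, loopField, ← hu, ← hu', map_sub, sub_apply]
    abel
  have h1 : ‖(G v - G w) u‖ ≤ KG * (|k| * zeta σ) * ‖v - w‖ := by
    calc _ ≤ ‖G v - G w‖ * ‖u‖ := ContinuousLinearMap.le_opNorm _ _
      _ ≤ (KG * ‖v - w‖) * (|k| * zeta σ) := by
        gcongr
        · exact hKG v hv w hw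
        · exact norm_radialLaw_satZeta_le hrc hσ0 hσ _
      _ = _ := by ring
  have h2 : ‖G w (u - u')‖ ≤ B * L * ‖v - w‖ := by
    calc _ ≤ ‖G w‖ * ‖u - u'‖ := ContinuousLinearMap.le_opNorm _ _
      _ ≤ B * (L * ‖v - w‖) := by
        gcongr
        · exact hP.G_le w
        · simpa using hL (v - c t) (w - c t)
      _ = _ := by ring
  rw [e1]
  refine (norm_add_le _ _).trans ?_
  have := norm_add_le ((G v - G w) u) (G w (u - u'))
  have := hKf v hv w hw
  linarith

/-- Solutions of the saturated closed loop are unique. -/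
theorem RegularPlant.eqOn_of_solvesOff [ProperSpace E] (hP : RegularPlant f G ω S τ B)
    (hrc : 0 < rc) (hσ0 : 0 ≤ σ) (hσ : σ < 1) {S' : Finset ℝ} {a b : ℝ} {x y : ℝ → E}
    (hx : SolvesOff S' (loopField f G ω k rc c (satZeta σ)) a b x)
    (hy : SolvesOff S' (loopField f G ω k rc c (satZeta σ)) a b y) (hxy : x a = y a) :
    EqOn x y (Icc a b) := by
  obtain ⟨R₁, hR₁⟩ := isCompact_Icc.exists_bound_of_continuousOn hx.1
  obtain ⟨R₂, hR₂⟩ := isCompact_Icc.exists_bound_of_continuousOn hy.1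
  obtain ⟨K, -, hK⟩ := hP.exists_lipschitz_loopField k c hrc hσ0 hσ (max R₁ R₂)
  exact hx.eqOn hy hxy
    (fun t ht => mem_closedBall_zero_iff.2 ((hR₁ t ht).trans (le_max_left _ _)))
    (fun t ht => mem_closedBall_zero_iff.2 ((hR₂ t ht).trans (le_max_right _ _)))
    (fun t _ => hK t)

/-- Picard–Lindelöf needs continuity in time, which ω lacks on S. Subtracting a primitive of ω from
the solution removes ω from the equation. -/
theorem RegularPlant.exists_primitive [ProperSpace E]
    (hP : RegularPlant f G ω S τ B) (hτ : 0 < τ) :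
    ∃ Ω : ℝ → E, Ω 0 = 0 ∧ ContinuousOn Ω (Icc 0 τ) ∧
      ∀ t ∈ Ioo 0 τ, t ∉ S → HasDerivAt Ω (ω t) t := by
  have hopen : IsOpen (Ioo 0 τ \ (S : Set ℝ)) := isOpen_Ioo.sdiff S.finite_toSet.isClosed
  have hcont : ContinuousOn ω (Ioo 0 τ \ (S : Set ℝ)) := fun t ht =>
    (hP.ω_continuousAt t ht.1 (by simpa using ht.2)).continuousWithinAt
  have hae : (Ioo 0 τ \ (S : Set ℝ) : Set ℝ) =ᵐ[MeasureTheory.volume] Ioc 0 τ :=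
    (MeasureTheory.sdiff_null_ae_eq_self (S.finite_toSet.measure_zero _)).trans
      MeasureTheory.Ioo_ae_eq_Ioc
  have hint : IntervalIntegrable ω MeasureTheory.volume 0 τ := by
    rw [intervalIntegrable_iff_integrableOn_Ioc_of_le hτ.le,
      ← MeasureTheory.integrableOn_congr_set_ae hae]
    refine MeasureTheory.IntegrableOn.of_bound ?_
      (hcont.aestronglyMeasurable hopen.measurableSet) B ?_
    · exact (MeasureTheory.measure_mono (sdiff_subset.trans Ioo_subset_Icc_self)).trans_lt
        measure_Icc_lt_top
    · filter_upwards [MeasureTheory.ae_restrict_mem hopen.measurableSet] with t ht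
      exact hP.ω_le t (Ioo_subset_Icc_self ht.1)
  refine ⟨fun t => ∫ s in (0 : ℝ)..t, ω s, by simp, ?_, fun t ht htS => ?_⟩
  · have := intervalIntegral.continuousOn_primitive_interval' hint left_mem_uIcc
    rwa [uIcc_of_le hτ.le] at this
  · refine intervalIntegral.integral_hasDerivAt_right
      (hint.mono_set (uIcc_subset_uIcc left_mem_uIcc ?_))
      (hcont.stronglyMeasurableAtFilter hopen t ⟨ht, by simpa using htS⟩)
      (hP.ω_continuousAt t ht htS)
    rw [uIcc_of_le hτ.le]
    exact Ioo_subset_Icc_self ht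

/-- Global existence for the saturated closed loop. -/
theorem RegularPlant.exists_solvesOff [ProperSpace E]
    (hP : RegularPlant f G ω S τ B) (hτ : 0 < τ) (hc : ContinuousOn c (Icc 0 τ)) (k : ℝ)
    (hrc : 0 < rc) (hσ0 : 0 ≤ σ) (hσ : σ < 1) (x₀ : E) :
    ∃ x : ℝ → E, x 0 = x₀ ∧ SolvesOff S (loopField f G ω k rc c (satZeta σ)) 0 τ x := by
  obtain ⟨Ω, hΩ0, hΩc, hΩd⟩ := hP.exists_primitive hτ
  obtain ⟨W, hW⟩ := isCompact_Icc.exists_bound_of_continuousOn hΩc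
  have hB := hP.bound_nonneg
  have hζ := zeta_nonneg hσ0 hσ
  -- The field for y = x - Ω; it no longer contains ω and is continuous in t.
  set F : ℝ → E → E := fun t y => loopField f G ω k rc c (satZeta σ) t (y + Ω t) - ω t with hF
  have hF' : ∀ t y, F t y
      = f (y + Ω t) + G (y + Ω t) (radialLaw (satZeta σ) k rc (y + Ω t - c t)) := fun t y => by
    simp [hF, loopField]
  set M : ℝ := B + B * (|k| * zeta σ) with hM
  have hM0 : 0 ≤ M := by positivity
  have hFM : ∀ t y, ‖F t y‖ ≤ M := fun t y => by
    rw [hF']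
    refine (norm_add_le _ _).trans (add_le_add (hP.f_le _) ?_)
    refine (ContinuousLinearMap.le_opNorm _ _).trans ?_
    gcongr
    · exact hP.G_le _
    · exact norm_radialLaw_satZeta_le hrc hσ0 hσ _
  -- Since F is bounded by M everywhere, y stays within M τ of x₀ during all of [0, τ], so one
  -- Picard–Lindelöf step covers the interval. The Lipschitz constant is taken on a ball that
  -- contains all the corresponding points y + Ω.
  obtain ⟨K, hK0, hK⟩ :=
    hP.exists_lipschitz_loopField k c hrc hσ0 hσ (‖x₀‖ + M * τ + W)
  have hmem : ∀ t ∈ Icc 0 τ, ∀ y ∈ Metric.closedBall x₀ (M * τ),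
      y + Ω t ∈ Metric.closedBall (0 : E) (‖x₀‖ + M * τ + W) := fun t ht y hy => by
    rw [mem_closedBall_zero_iff]
    rw [mem_closedBall_iff_norm] at hy
    have h1 := norm_add_le y (Ω t)
    have h2 := norm_le_norm_add_norm_sub' y x₀
    have h3 := hW t ht
    linarith
  obtain ⟨Lr, -, hLr⟩ := exists_norm_radialLaw_satZeta_sub_le (E := E) k hrc hσ0 hσ
  have hrad : Continuous (radialLaw (satZeta σ) k rc : E → E) :=
    (LipschitzWith.of_dist_le' fun a b => by
      simpa [dist_eq_norm] using hLr a b).continuous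
  have hPL : IsPicardLindelof F (tmin := 0) (tmax := τ) ⟨0, left_mem_Icc.2 hτ.le⟩ x₀
      ⟨M * τ, by positivity⟩ 0 ⟨M, hM0⟩ ⟨K, hK0⟩ := by
    refine ⟨fun t ht => ?_, fun y _ => ?_, fun t _ y _ => hFM t y, ?_⟩
    · refine LipschitzOnWith.of_dist_le_mul fun v hv w hw => ?_
      have := hK t _ (hmem t ht v hv) _ (hmem t ht w hw)
      rw [add_sub_add_right_eq_sub] at this
      simpa only [hF, dist_eq_norm, sub_sub_sub_cancel_right] using! this
    · simp only [hF']
      have h1 : ContinuousOn (fun t => y + Ω t) (Icc 0 τ) := continuousOn_const.add hΩc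
      exact (hP.f_lipschitz.continuous.comp_continuousOn h1).add
        ((hP.G_lipschitz.continuous.comp_continuousOn h1).clm_apply
          (hrad.comp_continuousOn (h1.sub hc)))
    · simp only [sub_zero, sub_self, NNReal.coe_zero, max_eq_left hτ.le]
      exact le_rfl
  obtain ⟨y, hy0, hy⟩ := hPL.exists_eq_forall_mem_Icc_hasDerivWithinAt₀
  refine ⟨fun t => y t + Ω t, by simpa [hΩ0] using hy0,
    (HasDerivWithinAt.continuousOn hy).add hΩc, fun t ht htS => ?_⟩
  have h1 := (hy t (Ioo_subset_Icc_self ht)).hasDerivAt (Icc_mem_nhds ht.1 ht.2)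
  have h2 := h1.add (hΩd t ht htS)
  have h3 : F t (y t) + ω t = loopField f G ω k rc c (satZeta σ) t (y t + Ω t) := by
    simp [hF]
  rw [h3] at h2
  exact h2

end Loop

end VCZ

namespace VCZ

/-! ### Confinement -/

variable {E : Type*} [NormedAddCommGroup E] [InnerProductSpace ℝ E]

theorem SolvesOff.congr {S : Finset ℝ} {F : ℝ → E → E} {a b : ℝ} {x y : ℝ → E}
    (h : SolvesOff S F a b x) (hxy : EqOn y x (Icc a b)) : SolvesOff S F a b y := by
  refine ⟨h.1.congr hxy, fun t ht htS => ?_⟩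
  rw [hxy (Ioo_subset_Icc_self ht)]
  refine (h.2 t ht htS).congr_of_eventuallyEq ?_
  filter_upwards [Icc_mem_nhds ht.1 ht.2] with s hs using hxy hs

/-- Pointwise positivity becomes uniform by taking the minimum over Q times the unit sphere and
scaling. If that product is empty, any positive constant serves. -/
theorem exists_pos_mul_sq_le_inner [ProperSpace E] {G : E → E →L[ℝ] E} (hG : Continuous G)
    {k : ℝ} (hpos : ∀ x v, v ≠ 0 → 0 < k * inner ℝ v (G x v)) {Q : Set E} (hQ : IsCompact Q) :
    ∃ l > 0, ∀ x ∈ Q, ∀ v, l * ‖v‖ ^ 2 ≤ k * inner ℝ v (G x v) := by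
  have hcpt : IsCompact (Q ×ˢ Metric.sphere (0 : E) 1) := hQ.prod (isCompact_sphere 0 1)
  have hcont : Continuous fun q : E × E => k * inner ℝ q.2 (G q.1 q.2) :=
    continuous_const.mul (continuous_snd.inner ((hG.comp continuous_fst).clm_apply continuous_snd))
  obtain ⟨l, hl, hle⟩ : ∃ l > 0, ∀ q ∈ Q ×ˢ Metric.sphere (0 : E) 1,
      l ≤ k * inner ℝ q.2 (G q.1 q.2) := by
    rcases (Q ×ˢ Metric.sphere (0 : E) 1).eq_empty_or_nonempty with he | hne
    · exact ⟨1, one_pos, by simp [he]⟩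
    · obtain ⟨q, hq, hmin⟩ := hcpt.exists_isMinOn hne hcont.continuousOn
      refine ⟨_, hpos q.1 q.2 ?_, fun r hr => hmin hr⟩
      exact ne_zero_of_mem_unit_sphere ⟨q.2, hq.2⟩
  refine ⟨l, hl, fun x hx v => ?_⟩
  rcases eq_or_ne v 0 with rfl | hv
  · simp
  have hv' : ‖v‖ ≠ 0 := norm_ne_zero_iff.2 hv
  have h1 := hle (x, ‖v‖⁻¹ • v) ⟨hx, by simp [norm_smul, hv']⟩
  simp only [map_smul, real_inner_smul_left, real_inner_smul_right] at h1
  calc l * ‖v‖ ^ 2 ≤ k * (‖v‖⁻¹ * (‖v‖⁻¹ * inner ℝ v (G x v))) * ‖v‖ ^ 2 := by gcongr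
    _ = _ := by field_simp

/-- The confinement law pushes inwards in the outer half of the zone, even when measured from a
slightly displaced center. -/
theorem inner_radialLaw_le {A : E →L[ℝ] E} {B l k rc : ℝ} {e d : E} (hl : 0 < l) (hrc : 0 < rc)
    (hA : ‖A‖ ≤ B) (hpos : l * ‖e‖ ^ 2 ≤ k * inner ℝ e (A e))
    (hd : |k| * B * ‖d‖ ≤ l * rc / 4) (he : rc / 2 ≤ ‖e‖) (he' : ‖e‖ < rc) :
    inner ℝ (e + d) (A (radialLaw zeta k rc e)) ≤ -(zeta (‖e‖ / rc) * (l * rc / 4)) := by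
  have he0 : 0 < ‖e‖ := by linarith
  have hz : 0 ≤ zeta (‖e‖ / rc) := zeta_nonneg (by positivity) ((div_lt_one hrc).2 he')
  -- In the quotient the main term is at least l ‖e‖ ≥ l rc / 2, and the displacement d spoils at
  -- most l rc / 4 of it.
  have h1 : inner ℝ (e + d) (A (radialLaw zeta k rc e))
      = -(zeta (‖e‖ / rc) * ((k * inner ℝ e (A e) + k * inner ℝ d (A e)) / ‖e‖)) := by
    simp only [radialLaw, map_neg, map_smul, inner_neg_right, real_inner_smul_right,
      inner_add_left]
    ring
  have h2 : |k * inner ℝ d (A e)| ≤ l * rc / 4 * ‖e‖ := by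
    rw [abs_mul]
    calc |k| * |inner ℝ d (A e)| ≤ |k| * (‖d‖ * (B * ‖e‖)) := by
          gcongr
          refine (abs_real_inner_le_norm _ _).trans ?_
          gcongr
          exact A.le_of_opNorm_le hA e
      _ = |k| * B * ‖d‖ * ‖e‖ := by ring
      _ ≤ _ := by gcongr
  have h3 := neg_abs_le (k * inner ℝ d (A e))
  have h4 : l * rc / 4 ≤ (k * inner ℝ e (A e) + k * inner ℝ d (A e)) / ‖e‖ := by
    rw [le_div_iff₀ he0]
    have : l * rc / 4 * ‖e‖ + l * rc / 4 * ‖e‖ ≤ l * ‖e‖ ^ 2 := by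
      have := mul_le_mul_of_nonneg_left he (by positivity : 0 ≤ l * ‖e‖)
      nlinarith
    linarith
  rw [h1]
  exact neg_le_neg (mul_le_mul_of_nonneg_left h4 hz)

section Margin

variable {f : E → E} {G : E → E →L[ℝ] E} {ω : ℝ → E} {S : Finset ℝ} {τ B : ℝ}
  {c : ℝ → E} {k rc : ℝ}

/-- The left-hand sides are the derivative of ‖x - c'‖² for a frozen center c'. In the outer half of
the zone the law pushes inwards; in the inner half it is bounded by its value at 1/2. So the
derivative is bounded above throughout, and very negative near the boundary. -/
theorem RegularPlant.inner_loopField_le (hP : RegularPlant f G ω S τ B) {t l : ℝ} {x c' : E}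
    (hl : 0 < l) (hrc : 0 < rc) (ht : t ∈ Icc 0 τ)
    (hpos : ∀ v, l * ‖v‖ ^ 2 ≤ k * inner ℝ v (G x v)) (hx : ‖x - c t‖ < rc)
    (hd : ‖c t - c'‖ ≤ rc) (hd' : |k| * B * ‖c t - c'‖ ≤ l * rc / 4) :
    2 * inner ℝ (x - c') (loopField f G ω k rc c zeta t x)
        ≤ 8 * rc * B + 4 * rc * B * (|k| * zeta (1 / 2)) ∧
      (rc / 2 ≤ ‖x - c t‖ → 2 * inner ℝ (x - c') (loopField f G ω k rc c zeta t x)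
        ≤ 8 * rc * B - zeta (‖x - c t‖ / rc) * (l * rc / 2)) := by
  have hB := hP.bound_nonneg
  have hz2 : 0 ≤ zeta (1 / 2) := zeta_nonneg (by norm_num) (by norm_num)
  set e := x - c t with he
  set d := c t - c' with hdd
  have hed : x - c' = e + d := by rw [he, hdd]; abel
  have hnorm : ‖e + d‖ ≤ 2 * rc := (norm_add_le _ _).trans (by linarith)
  have h1 : inner ℝ (e + d) (f x + ω t) ≤ 2 * rc * (2 * B) := by
    refine (real_inner_le_norm _ _).trans ?_
    gcongr
    refine (norm_add_le _ _).trans ?_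
    have := hP.f_le x
    have := hP.ω_le t ht
    linarith
  have h2 : inner ℝ (x - c') (loopField f G ω k rc c zeta t x)
      = inner ℝ (e + d) (f x + ω t) + inner ℝ (e + d) (G x (radialLaw zeta k rc e)) := by
    rw [hed, ← inner_add_right, loopField, ← he]
    congr 1
    abel
  have h3 : rc / 2 ≤ ‖e‖ → inner ℝ (e + d) (G x (radialLaw zeta k rc e))
      ≤ -(zeta (‖e‖ / rc) * (l * rc / 4)) := fun h =>
    inner_radialLaw_le hl hrc (hP.G_le x) (hpos e) hd' h hx
  refine ⟨?_, fun h => ?_⟩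
  · have hrhs : 0 ≤ 4 * rc * B * (|k| * zeta (1 / 2)) := by positivity
    rcases le_or_gt (rc / 2) ‖e‖ with h | h
    · have hz : 0 ≤ zeta (‖e‖ / rc) * (l * rc / 4) :=
        mul_nonneg (zeta_nonneg (by positivity) ((div_lt_one hrc).2 hx)) (by positivity)
      linarith [h3 h]
    · have h4 : inner ℝ (e + d) (G x (radialLaw zeta k rc e))
          ≤ 2 * rc * (B * (|k| * zeta (1 / 2))) := by
        refine (real_inner_le_norm _ _).trans ?_
        gcongr
        refine (G x).le_of_opNorm_le_of_le (hP.G_le x) ((norm_radialLaw_le _ _ _ _).trans ?_)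
        have hs : ‖e‖ / rc ≤ 1 / 2 := by rw [div_le_iff₀ hrc]; linarith
        rw [abs_of_nonneg (zeta_nonneg (by positivity) (by linarith))]
        gcongr
        exact zeta_mono (by positivity) hs (by norm_num)
      linarith
  · linarith [h3 h]

/-- A solution that stays in the moving zone on `[0, T)` keeps a positive distance from its
boundary, provided the center is Lipschitz from the left at `T`. -/
theorem RegularPlant.exists_margin [ProperSpace E] (hP : RegularPlant f G ω S τ B)
    (hc : ContinuousOn c (Icc 0 τ)) (hrc : 0 < rc)
    (hpos : ∀ x v, v ≠ 0 → 0 < k * inner ℝ v (G x v)) {T : ℝ} (hT : T ∈ Ioc 0 τ)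
    (hcalm : ∃ L, ∀ᶠ t in 𝓝[<] T, ‖c t - c T‖ ≤ L * (T - t)) {x : ℝ → E}
    (hx : ∀ b ∈ Ico 0 T, SolvesOff S (loopField f G ω k rc c zeta) 0 b x)
    (hconf : ∀ t ∈ Ico 0 T, ‖x t - c t‖ < rc) :
    ∃ ρ < rc, ∀ t ∈ Ico 0 T, ‖x t - c t‖ ≤ ρ := by
  have hB := hP.bound_nonneg
  have hIco : ∀ t ∈ Ico 0 T, t ∈ Icc 0 τ := fun t ht => ⟨ht.1, ht.2.le.trans hT.2⟩
  -- Only times near T matter: on [0, b] compactness gives the gap.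
  suffices hlast : ∃ b ∈ Ico 0 T, ∃ ρ < rc, ∀ t ∈ Ico b T, ‖x t - c t‖ ≤ ρ by
    obtain ⟨b, hb, ρ, hρ, hle⟩ := hlast
    have hcont : ContinuousOn (fun t => ‖x t - c t‖) (Icc 0 b) :=
      ((hx b hb).1.sub (hc.mono (Icc_subset_Icc_right (hIco b hb).2))).norm
    obtain ⟨m, hm, hmax⟩ := isCompact_Icc.exists_isMaxOn (nonempty_Icc.2 hb.1) hcont
    refine ⟨max ρ ‖x m - c m‖, max_lt hρ (hconf m ⟨hm.1, hm.2.trans_lt hb.2⟩), fun t ht => ?_⟩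
    rcases le_total t b with h | h
    · exact (hmax ⟨ht.1, h⟩).trans (le_max_right _ _)
    · exact (hle t ⟨h, ht.2⟩).trans (le_max_left _ _)
  obtain ⟨C₀, hC₀⟩ := isCompact_Icc.exists_bound_of_continuousOn hc
  obtain ⟨l, hl, hlpos⟩ := exists_pos_mul_sq_le_inner hP.G_lipschitz.continuous hpos
    (isCompact_closedBall (0 : E) (C₀ + rc))
  have hxball : ∀ t ∈ Ico 0 T, x t ∈ Metric.closedBall (0 : E) (C₀ + rc) := fun t ht => by
    rw [mem_closedBall_zero_iff]
    have h1 := norm_le_norm_add_norm_sub' (x t) (c t)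
    linarith [hC₀ t (hIco t ht), hconf t ht]
  obtain ⟨L, hL, hcL⟩ : ∃ L > 0, ∀ᶠ t in 𝓝[<] T, ‖c t - c T‖ ≤ L * (T - t) := by
    obtain ⟨L, hL⟩ := hcalm
    refine ⟨max L 1, lt_max_of_lt_right one_pos, ?_⟩
    filter_upwards [hL, self_mem_nhdsWithin] with t ht htT
    exact ht.trans (mul_le_mul_of_nonneg_right (le_max_left _ _)
      (sub_nonneg.2 (mem_Iio.1 htT).le))
  obtain ⟨s₀, hs₀T, hs₀⟩ := (mem_nhdsLT_iff_exists_Ioo_subset' hT.1).1 hcL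
  -- the level above which the inward push dominates
  obtain ⟨σ₁, hσ₁, hσ₁half, hpush⟩ : ∃ σ₁ < 1, 1 / 2 ≤ σ₁ ∧ ∀ s, σ₁ ≤ s → s < 1 →
      8 * rc * B - zeta s * (l * rc / 2) ≤ -(8 * rc * L) := by
    have hev : ∀ᶠ s in 𝓝[<] (1 : ℝ), (8 * rc * B + 8 * rc * L) / (l * rc / 2) ≤ zeta s ∧ 1 / 2 < s :=
      (tendsto_zeta.eventually_ge_atTop _).and
        (mem_nhdsWithin_of_mem_nhds (Ioi_mem_nhds (by norm_num)))
    obtain ⟨σ₁, ⟨h1, h2⟩, h3⟩ := (hev.and self_mem_nhdsWithin).exists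
    refine ⟨σ₁, h3, h2.le, fun s hs hs1 => ?_⟩
    rw [div_le_iff₀ (by positivity)] at h1
    have := mul_le_mul_of_nonneg_right (zeta_mono (by linarith) hs hs1)
      (by positivity : 0 ≤ l * rc / 2)
    linarith
  set C := 8 * rc * B + 4 * rc * B * (|k| * zeta (1 / 2)) with hC
  have hC0 : 0 ≤ C := by
    have : 0 ≤ zeta (1 / 2) := zeta_nonneg (by norm_num) (by norm_num)
    positivity
  have hσrc : σ₁ * rc < (1 + σ₁) / 2 * rc := by
    gcongr
    linarith
  -- a short final interval
  obtain ⟨δ, hδ0, hδT, hδs, hδ1, hδ2, hδ3, hδ4⟩ : ∃ δ > 0, δ < T ∧ δ < T - s₀ ∧ L * δ < rc ∧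
      |k| * B * (L * δ) < l * rc / 4 ∧ L * δ < (1 - σ₁) / 4 * rc ∧
      (σ₁ * rc + L * δ) ^ 2 + C * δ < ((1 + σ₁) / 2 * rc) ^ 2 := by
    have h1 : Tendsto (fun δ : ℝ => L * δ) (𝓝 0) (𝓝 (L * 0)) :=
      (continuous_const.mul continuous_id).tendsto 0
    have h2 : Tendsto (fun δ : ℝ => |k| * B * (L * δ)) (𝓝 0) (𝓝 (|k| * B * (L * 0))) :=
      Continuous.tendsto (by fun_prop) 0
    have h3 : Tendsto (fun δ : ℝ => (σ₁ * rc + L * δ) ^ 2 + C * δ) (𝓝 0)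
        (𝓝 ((σ₁ * rc + L * 0) ^ 2 + C * 0)) := Continuous.tendsto (by fun_prop) 0
    have hev := (gt_mem_nhds hT.1).and ((gt_mem_nhds (sub_pos.2 hs₀T)).and
      ((h1.eventually_lt_const (u := rc) (by linarith)).and
      ((h2.eventually_lt_const (u := l * rc / 4) (by simp; positivity)).and
      ((h1.eventually_lt_const (u := (1 - σ₁) / 4 * rc) (by
        rw [mul_zero]; exact mul_pos (by linarith) hrc)).and
      (h3.eventually_lt_const (u := ((1 + σ₁) / 2 * rc) ^ 2) (by
        rw [mul_zero, mul_zero, add_zero, add_zero]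
        gcongr))))))
    obtain ⟨δ, hδ, hδ0⟩ := ((hev.filter_mono nhdsWithin_le_nhds).and
      (self_mem_nhdsWithin : Ioi (0 : ℝ) ∈ 𝓝[>] 0)).exists
    exact ⟨δ, hδ0, hδ⟩
  have hcδ : ∀ t ∈ Ico (T - δ) T, ‖c t - c T‖ ≤ L * (T - t) := fun t ht =>
    hs₀ ⟨by linarith [ht.1], ht.2⟩
  have hcδ' : ∀ t ∈ Ico (T - δ) T, ‖c t - c T‖ ≤ L * δ := fun t ht =>
    (hcδ t ht).trans (mul_le_mul_of_nonneg_left (by linarith [ht.1]) hL.le)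
  have hIcoδ : ∀ t ∈ Ico (T - δ) T, t ∈ Ico 0 T := fun t ht => ⟨by linarith [ht.1], ht.2⟩
  have hfield : ∀ t ∈ Ico (T - δ) T,
      2 * inner ℝ (x t - c T) (loopField f G ω k rc c zeta t (x t)) ≤ C ∧
      (σ₁ * rc ≤ ‖x t - c t‖ →
        2 * inner ℝ (x t - c T) (loopField f G ω k rc c zeta t (x t)) ≤ -(8 * rc * L)) := by
    intro t ht
    have ht0 := hIcoδ t ht
    have := hP.inner_loopField_le (c := c) (c' := c T) hl hrc (hIco t ht0)
      (hlpos _ (hxball t ht0)) (hconf t ht0) ((hcδ' t ht).trans hδ1.le)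
      ((mul_le_mul_of_nonneg_left (hcδ' t ht) (by positivity)).trans hδ2.le)
    refine ⟨this.1, fun h => (this.2 ?_).trans (hpush _ ?_ ?_)⟩
    · exact le_trans (by rw [div_eq_mul_inv, mul_comm]; gcongr; linarith) h
    · rwa [le_div_iff₀ hrc]
    · exact (div_lt_one hrc).2 (hconf t ht0)
  -- growth of the squared distance to the final center
  have hgrow : ∀ (a b M : ℝ), T - δ ≤ a → a ≤ b → b < T →
      (∀ t ∈ Ioo a b, 2 * inner ℝ (x t - c T) (loopField f G ω k rc c zeta t (x t)) ≤ M) →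
      ‖x b - c T‖ ^ 2 ≤ ‖x a - c T‖ ^ 2 + M * (b - a) := by
    intro a b M ha hab hb hM
    have hb0 : b ∈ Ico 0 T := ⟨by linarith, hb⟩
    have hsol := hx b hb0
    have := sub_le_mul_sub_of_deriv_le_off_finset S (φ := fun t => ‖x t - c T‖ ^ 2) hab
      (((hsol.1.mono (Icc_subset_Icc_left (by linarith))).sub continuousOn_const).norm.pow 2)
      (fun t ht htS =>
        ((hsol.2 t ⟨by linarith [ht.1], ht.2⟩ htS).sub_const (c T)).norm_sq)
      (fun t ht _ => hM t ht)
    linarith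
  have hdist : ∀ t ∈ Ico (T - δ) T, ‖x t - c T‖ ≤ ‖x t - c t‖ + L * δ ∧
      ‖x t - c t‖ ≤ ‖x t - c T‖ + L * (T - t) := by
    intro t ht
    have h1 := norm_sub_le_norm_sub_add_norm_sub (x t) (c t) (c T)
    have h2 := norm_sub_le_norm_sub_add_norm_sub (x t) (c T) (c t)
    rw [norm_sub_rev (c T)] at h2
    exact ⟨h1.trans (by linarith [hcδ' t ht]), h2.trans (by linarith [hcδ t ht])⟩
  -- If ‖e‖ dips below σ₁ r_c at some a in the final window, then ‖x - c(T)‖² grows by at most C δ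
  -- afterwards, and δ was chosen so small that this stays away from r_c². Otherwise the strong push
  -- acts throughout the window.
  by_cases hcase : ∃ a ∈ Ico (T - δ) T, ‖x a - c a‖ < σ₁ * rc
  · obtain ⟨a, ha, hxa⟩ := hcase
    refine ⟨a, hIcoδ a ha, (1 + σ₁) / 2 * rc + (1 - σ₁) / 4 * rc, ?_, fun t ht => ?_⟩
    · nlinarith
    have htδ : t ∈ Ico (T - δ) T := ⟨ha.1.trans ht.1, ht.2⟩
    have h1 := hgrow a t C ha.1 ht.1 ht.2
      (fun r hr => (hfield r ⟨ha.1.trans hr.1.le, hr.2.trans ht.2⟩).1)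
    have h2 : ‖x a - c T‖ ^ 2 ≤ (σ₁ * rc + L * δ) ^ 2 := by
      gcongr
      linarith [(hdist a ha).1]
    have h3 : C * (t - a) ≤ C * δ :=
      mul_le_mul_of_nonneg_left (by linarith [ha.1, ht.2]) hC0
    have h4 : ‖x t - c T‖ ≤ (1 + σ₁) / 2 * rc :=
      le_of_abs_le (abs_le_of_sq_le_sq (by linarith) (by nlinarith))
    have h5 : L * (T - t) ≤ L * δ := mul_le_mul_of_nonneg_left (by linarith [htδ.1]) hL.le
    linarith [(hdist t htδ).2]
  · push Not at hcase
    have haδ : T - δ ∈ Ico (T - δ) T := ⟨le_rfl, by linarith⟩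
    have hη : 0 < rc * L * δ := by positivity
    -- The window starts with at most (r_c + Lδ)² ≤ r_c² + 3 r_c L δ, since L δ < r_c. Half a window
    -- at rate -8 r_c L removes at least 4 r_c L δ, leaving a net gain of r_c L δ.
    have hsq : ∀ t ∈ Ico (T - δ / 2) T, ‖x t - c T‖ ^ 2 ≤ rc ^ 2 - rc * L * δ := by
      intro t ht
      have h1 := hgrow (T - δ) t (-(8 * rc * L)) le_rfl (by linarith [ht.1]) ht.2
        (fun r hr => (hfield r ⟨hr.1.le, hr.2.trans ht.2⟩).2
          (hcase r ⟨hr.1.le, hr.2.trans ht.2⟩))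
      have h2 : ‖x (T - δ) - c T‖ ^ 2 ≤ (rc + L * δ) ^ 2 := by
        gcongr
        linarith [(hdist _ haδ).1, hconf _ (hIcoδ _ haδ)]
      have h3 : (L * δ) * (L * δ) ≤ rc * (L * δ) := by gcongr
      have h4 : 8 * rc * L * (δ / 2) ≤ 8 * rc * L * (t - (T - δ)) := by
        gcongr
        linarith [ht.1]
      nlinarith
    have hη' : 0 ≤ rc ^ 2 - rc * L * δ := by nlinarith
    set ρ₀ := √(rc ^ 2 - rc * L * δ) with hρ₀
    have hρ₀rc : ρ₀ < rc := by
      rw [hρ₀, Real.sqrt_lt' hrc]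
      linarith
    -- Close enough to T, passing from c(T) back to c(t) uses up only half of the gap r_c - ρ₀.
    obtain ⟨b, hb1, hb2, hb3⟩ : ∃ b, T - δ / 2 ≤ b ∧ b < T ∧ L * (T - b) ≤ (rc - ρ₀) / 2 := by
      refine ⟨T - min (δ / 2) ((rc - ρ₀) / 2 / L),
        by linarith [min_le_left (δ / 2) ((rc - ρ₀) / 2 / L)], ?_, ?_⟩
      · have : 0 < min (δ / 2) ((rc - ρ₀) / 2 / L) :=
          lt_min (by linarith) (div_pos (by linarith) hL)
        linarith
      · rw [sub_sub_cancel, mul_comm, ← le_div_iff₀ hL]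
        exact min_le_right _ _
    refine ⟨b, ⟨by linarith, hb2⟩, (rc + ρ₀) / 2, by linarith, fun t ht => ?_⟩
    have htδ : t ∈ Ico (T - δ) T := ⟨by linarith [ht.1], ht.2⟩
    have h1 : ‖x t - c T‖ ≤ ρ₀ := Real.le_sqrt_of_sq_le (hsq t ⟨hb1.trans ht.1, ht.2⟩)
    have h2 : L * (T - t) ≤ L * (T - b) := mul_le_mul_of_nonneg_left (by linarith [ht.1]) hL.le
    linarith [(hdist t htδ).2]

end Margin

end VCZ

namespace VCZ

/-! ### Existence and uniqueness of confined solutions -/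

variable {E : Type*} [NormedAddCommGroup E] [InnerProductSpace ℝ E] [ProperSpace E]
  {f : E → E} {G : E → E →L[ℝ] E} {ω : ℝ → E} {S : Finset ℝ} {τ B : ℝ}
  {c : ℝ → E} {k rc : ℝ}

omit [ProperSpace E] in
theorem SolvesOff.satZeta {a b σ : ℝ} {x : ℝ → E} (hrc : 0 < rc)
    (hx : SolvesOff S (loopField f G ω k rc c zeta) a b x)
    (hconf : ∀ t ∈ Icc a b, ‖x t - c t‖ ≤ σ * rc) :
    SolvesOff S (loopField f G ω k rc c (satZeta σ)) a b x :=
  hx.congr_field fun t ht => (loopField_satZeta_of_le hrc (hconf t (Ioo_subset_Icc_self ht))).symm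

/-- The closed loop has a solution that stays in the moving zone. -/
theorem RegularPlant.exists_confined (hP : RegularPlant f G ω S τ B) (hτ : 0 < τ)
    (hc : ContinuousOn c (Icc 0 τ)) (hrc : 0 < rc)
    (hpos : ∀ x v, v ≠ 0 → 0 < k * inner ℝ v (G x v))
    (hcalm : ∀ T ∈ Ioc 0 τ, ∃ L, ∀ᶠ t in 𝓝[<] T, ‖c t - c T‖ ≤ L * (T - t))
    {x₀ : E} (hx₀ : ‖x₀ - c 0‖ < rc) :
    ∃ x : ℝ → E, x 0 = x₀ ∧ SolvesOff S (loopField f G ω k rc c zeta) 0 τ x ∧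
      ∀ t ∈ Icc 0 τ, ‖x t - c t‖ < rc := by
  have hex : ∀ σ : ℝ, 0 ≤ σ → σ < 1 → ∃ x : ℝ → E, x 0 = x₀ ∧
      SolvesOff S (loopField f G ω k rc c (VCZ.satZeta σ)) 0 τ x := fun σ h0 h1 =>
    hP.exists_solvesOff hτ hc k hrc h0 h1 x₀
  choose! X hX0 hX using hex
  -- Up to time T the solution saturated at σ never feels the saturation. The strict inequality
  -- makes this condition extendable to the right.
  let P : ℝ → ℝ → Prop := fun σ T =>
    0 ≤ σ ∧ σ < 1 ∧ ∀ t ∈ Icc 0 T, ‖X σ t - c t‖ < σ * rc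
  have hPmono : ∀ {σ T T'}, P σ T → T' ≤ T → P σ T' := fun h hle =>
    ⟨h.1, h.2.1, fun t ht => h.2.2 t ⟨ht.1, ht.2.trans hle⟩⟩
  have hXzeta : ∀ {σ T}, P σ T → T ≤ τ →
      SolvesOff S (loopField f G ω k rc c zeta) 0 T (X σ) := fun {σ T} h hT =>
    ((hX σ h.1 h.2.1).mono (Finset.Subset.refl S) le_rfl hT).congr_field fun t ht =>
      loopField_satZeta_of_le hrc (h.2.2 t (Ioo_subset_Icc_self ht)).le
  -- A true solution confined to level σ also solves every equation saturated at σ' ≥ σ, where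
  -- uniqueness is available.
  have hagree : ∀ {σ σ' T : ℝ} {x : ℝ → E}, 0 ≤ σ' → σ' < 1 → σ ≤ σ' → T ≤ τ → x 0 = x₀ →
      SolvesOff S (loopField f G ω k rc c zeta) 0 T x →
      (∀ t ∈ Icc 0 T, ‖x t - c t‖ ≤ σ * rc) → EqOn x (X σ') (Icc 0 T) := by
    intro σ σ' T x h0 h1 hσ hT hx0 hx hxc
    refine hP.eqOn_of_solvesOff hrc h0 h1 (hx.satZeta hrc fun t ht => (hxc t ht).trans ?_)
      ((hX σ' h0 h1).mono (Finset.Subset.refl S) le_rfl hT) (hx0.trans (hX0 σ' h0 h1).symm)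
    gcongr
  have hagree' : ∀ {σ σ' T : ℝ}, P σ T → P σ' T → T ≤ τ → EqOn (X σ) (X σ') (Icc 0 T) := by
    intro σ σ' T h h' hT
    have hm : 0 ≤ max σ σ' := h.1.trans (le_max_left _ _)
    have hm1 : max σ σ' < 1 := max_lt h.2.1 h'.2.1
    exact (hagree hm hm1 (le_max_left _ _) hT (hX0 σ h.1 h.2.1) (hXzeta h hT)
      fun t ht => (h.2.2 t ht).le).trans (hagree hm hm1 (le_max_right _ _) hT
      (hX0 σ' h'.1 h'.2.1) (hXzeta h' hT) fun t ht => (h'.2.2 t ht).le).symm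
  have hXcont : ∀ σ, 0 ≤ σ → σ < 1 → ContinuousOn (fun t => ‖X σ t - c t‖) (Icc 0 τ) :=
    fun σ h0 h1 => ((hX σ h0 h1).1.sub hc).norm
  set A : Set ℝ := {T | T ∈ Icc 0 τ ∧ ∃ σ, P σ T} with hA
  have h0A : (0 : ℝ) ∈ A := by
    refine ⟨left_mem_Icc.2 hτ.le, (‖x₀ - c 0‖ / rc + 1) / 2, by positivity, ?_, fun t ht => ?_⟩
    · linarith [(div_lt_one hrc).2 hx₀]
    · have h1 := (div_lt_one hrc).2 hx₀
      obtain rfl : t = 0 := le_antisymm ht.2 ht.1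
      rw [hX0 _ (by positivity) (by linarith), ← div_lt_iff₀ hrc]
      linarith
  have hlub : IsLUB A (sSup A) := isLUB_csSup ⟨0, h0A⟩ ⟨τ, fun T hT => hT.1.2⟩
  set T := sSup A with hTdef
  have hT0 : 0 ≤ T := hlub.1 h0A
  have hTτ : T ≤ τ := hlub.2 fun t ht => ht.1.2
  have hbelow : ∀ t ∈ Ico 0 T, ∃ σ, P σ t := by
    intro t ht
    obtain ⟨T', hT', hlt⟩ := (lt_isLUB_iff hlub).1 ht.2
    obtain ⟨σ, hσ⟩ := hT'.2
    exact ⟨σ, hPmono hσ hlt.le⟩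
  have hTA : T ∈ A := by
    by_contra hTA
    have hTpos : 0 < T := lt_of_le_of_ne hT0 fun h => hTA (h ▸ h0A)
    -- The level s t may tend to 1 as t → T. Solutions for different levels agree where both are
    -- unsaturated, so t ↦ X (s t) t is one true solution on [0, T), to which the margin estimate
    -- applies.
    choose! s hs using hbelow
    have hsτ : ∀ t ∈ Ico 0 T, t ≤ τ := fun t ht => ht.2.le.trans hTτ
    have hxX : ∀ b ∈ Ico 0 T, EqOn (fun t => X (s t) t) (X (s b)) (Icc 0 b) := by
      intro b hb t ht
      have ht' : t ∈ Ico 0 T := ⟨ht.1, ht.2.trans_lt hb.2⟩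
      exact hagree' (hs t ht') (hPmono (hs b hb) ht.2) (hsτ t ht') ⟨ht.1, le_rfl⟩
    have hsol : ∀ b ∈ Ico 0 T,
        SolvesOff S (loopField f G ω k rc c zeta) 0 b (fun t => X (s t) t) := fun b hb =>
      (hXzeta (hs b hb) (hsτ b hb)).congr (hxX b hb)
    obtain ⟨ρ, hρ, hmargin⟩ := hP.exists_margin hc hrc hpos ⟨hTpos, hTτ⟩
      (hcalm T ⟨hTpos, hTτ⟩) hsol (fun t ht => by
        obtain ⟨-, h1, h2⟩ := hs t ht
        refine (h2 t ⟨ht.1, le_rfl⟩).trans_le ?_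
        exact mul_le_of_le_one_left hrc.le h1.le)
    have hρ0 : 0 ≤ ρ := (norm_nonneg _).trans (hmargin 0 ⟨le_rfl, hTpos⟩)
    have hρ1 : ρ / rc < 1 := (div_lt_one hrc).2 hρ
    -- A level strictly between ρ / r_c and 1, so that the bound by ρ passes to t = T by continuity
    -- and remains strictly below saturation.
    set σ := (ρ / rc + 1) / 2 with hσ
    have hσ0 : 0 ≤ σ := by positivity
    have hσ1 : σ < 1 := by linarith
    have hρσ : ρ < σ * rc := by
      rw [← div_lt_iff₀ hrc]
      linarith
    have hXρ : ∀ t ∈ Ico 0 T, ‖X σ t - c t‖ ≤ ρ := by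
      intro t ht
      have h00 : (fun t => X (s t) t) 0 = x₀ := by
        have := hs 0 ⟨le_rfl, hTpos⟩
        exact hX0 _ this.1 this.2.1
      have := hagree (x := fun t => X (s t) t) hσ0 hσ1 le_rfl (hsτ t ht) h00 (hsol t ht)
        (fun r hr => (hmargin r ⟨hr.1, hr.2.trans_lt ht.2⟩).trans hρσ.le) ⟨ht.1, le_rfl⟩
      exact this ▸ hmargin t ht
    have hclos : ∀ t ∈ Icc 0 T, ‖X σ t - c t‖ ≤ ρ := by
      have h1 : ContinuousOn (fun t => ‖X σ t - c t‖) (closure (Ico 0 T)) := by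
        rw [closure_Ico hTpos.ne]
        exact (hXcont σ hσ0 hσ1).mono (Icc_subset_Icc_right hTτ)
      have h2 := le_on_closure hXρ h1 continuousOn_const
      rwa [closure_Ico hTpos.ne] at h2
    exact hTA ⟨⟨hT0, hTτ⟩, σ, hσ0, hσ1, fun t ht => (hclos t ht).trans_lt hρσ⟩
  obtain ⟨σ, hσ⟩ := hTA.2
  have hTeq : T = τ := by
    by_contra hne
    have hTlt : T < τ := lt_of_le_of_ne hTτ hne
    have hev : ∀ᶠ t in 𝓝[Icc 0 τ] T, ‖X σ t - c t‖ < σ * rc :=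
      (hXcont σ hσ.1 hσ.2.1 T ⟨hT0, hTτ⟩).eventually_lt_const (hσ.2.2 T ⟨hT0, le_rfl⟩)
    have hev' : ∀ᶠ t in 𝓝[>] T, ‖X σ t - c t‖ < σ * rc := by
      refine hev.filter_mono ?_
      rw [← nhdsWithin_Ioc_eq_nhdsGT hTlt]
      exact nhdsWithin_mono _ fun t ht => ⟨hT0.trans ht.1.le, ht.2⟩
    obtain ⟨u, hu, hsub⟩ := (mem_nhdsGT_iff_exists_Ioo_subset' hTlt).1 hev'
    obtain ⟨v, hv1, hv2⟩ := exists_between (lt_min (mem_Ioi.1 hu) hTlt)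
    have hvA : v ∈ A := by
      refine ⟨⟨hT0.trans hv1.le, (hv2.trans_le (min_le_right _ _)).le⟩, σ, hσ.1, hσ.2.1,
        fun t ht => ?_⟩
      rcases le_or_gt t T with h | h
      · exact hσ.2.2 t ⟨ht.1, h⟩
      · exact hsub ⟨h, ht.2.trans_lt (hv2.trans_le (min_le_left _ _))⟩
    exact absurd (hlub.1 hvA) (not_le.2 hv1)
  rw [hTeq] at hσ
  refine ⟨X σ, hX0 σ hσ.1 hσ.2.1, hXzeta hσ le_rfl, fun t ht => (hσ.2.2 t ht).trans_le ?_⟩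
  exact mul_le_of_le_one_left hrc.le hσ.2.1.le

/-- Every solution of the closed loop agrees with a solution that stays in the moving zone. -/
theorem RegularPlant.eqOn_of_confined (hP : RegularPlant f G ω S τ B)
    (hrc : 0 < rc) {b : ℝ} (hb : 0 ≤ b) {S' : Finset ℝ}
    (hc : ContinuousOn c (Icc 0 b)) {x y : ℝ → E}
    (hx : SolvesOff S' (loopField f G ω k rc c zeta) 0 b x)
    (hconf : ∀ t ∈ Icc 0 b, ‖x t - c t‖ < rc)
    (hy : SolvesOff S' (loopField f G ω k rc c zeta) 0 b y) (hxy : y 0 = x 0) :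
    EqOn y x (Icc 0 b) := by
  -- The confined solution x attains its largest distance from the center, so it stays strictly
  -- below some level σ < 1.
  obtain ⟨m, hm, hmax⟩ := isCompact_Icc.exists_isMaxOn (nonempty_Icc.2 hb) (hx.1.sub hc).norm
  set ρ := ‖x m - c m‖ with hρ
  have hρ1 : ρ / rc < 1 := (div_lt_one hrc).2 (hconf m hm)
  set σ := (ρ / rc + 1) / 2 with hσ
  have hσ0 : 0 ≤ σ := by positivity
  have hσ1 : σ < 1 := by linarith
  have hxσ : ∀ t ∈ Icc 0 b, ‖x t - c t‖ < σ * rc := fun t ht => by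
    have hle : ‖x t - c t‖ ≤ ρ := hmax ht
    refine hle.trans_lt ?_
    clear_value ρ
    rw [← div_lt_iff₀ hrc]
    linarith
  have hclosed : IsClosed ({t | y t - x t = 0} ∩ Icc 0 b) := by
    rw [inter_comm]
    exact (hy.1.sub hx.1).preimage_isClosed_of_isClosed isClosed_Icc (isClosed_singleton (x := 0))
  -- Nothing confines y a priori. But where y agrees with x it is below level σ, hence remains so
  -- for a short time by continuity, and saturated uniqueness extends the agreement to the right.
  have hsub := hclosed.Icc_subset_of_forall_exists_gt (sub_eq_zero.2 hxy) fun t ht u hu => by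
    have hyt : y t = x t := sub_eq_zero.1 ht.1
    have htb : t < b := ht.2.2
    have hev : ∀ᶠ r in 𝓝[Icc 0 b] t, ‖y r - c r‖ < σ * rc :=
      ((hy.1.sub hc).norm t (Ico_subset_Icc_self ht.2)).eventually_lt_const (by
        simpa [hyt] using hxσ t (Ico_subset_Icc_self ht.2))
    have hev' : ∀ᶠ r in 𝓝[>] t, ‖y r - c r‖ < σ * rc := by
      refine hev.filter_mono ?_
      rw [← nhdsWithin_Ioc_eq_nhdsGT htb]
      exact nhdsWithin_mono _ fun r hr => ⟨ht.2.1.trans hr.1.le, hr.2⟩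
    obtain ⟨v, hv, hvsub⟩ := (mem_nhdsGT_iff_exists_Ioo_subset' htb).1 hev'
    obtain ⟨w, hw1, hw2⟩ := exists_between (lt_min (mem_Ioi.1 hv) (lt_min (mem_Ioi.1 hu) htb))
    simp only [lt_min_iff] at hw2
    have hr0 : ∀ r ∈ Icc t w, r ∈ Icc 0 b := fun r hr =>
      ⟨ht.2.1.trans hr.1, hr.2.trans hw2.2.2.le⟩
    have heq : EqOn y x (Icc t w) := by
      refine hP.eqOn_of_solvesOff hrc hσ0 hσ1
        ((hy.mono (Finset.Subset.refl _) ht.2.1 hw2.2.2.le).satZeta hrc fun r hr => ?_)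
        ((hx.mono (Finset.Subset.refl _) ht.2.1 hw2.2.2.le).satZeta hrc fun r hr =>
          (hxσ r (hr0 r hr)).le) hyt
      rcases eq_or_lt_of_le hr.1 with h | h
      · rw [← h, hyt]
        exact (hxσ t (Ico_subset_Icc_self ht.2)).le
      · exact (hvsub ⟨h, hr.2.trans_lt hw2.1⟩ : ‖y r - c r‖ < σ * rc).le
    exact ⟨w, sub_eq_zero.2 (heq ⟨hw1.le, le_rfl⟩), hw1, hw2.2.1.le⟩
  exact fun t ht => sub_eq_zero.1 (hsub ht)

end VCZ

namespace VCZ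

/-! ### The quadratic program and the barriers -/

theorem inner_toEuclideanCLM {n : ℕ} (A : Matrix (Fin n) (Fin n) ℝ) (v : Vec n) :
    inner ℝ v (Matrix.toEuclideanCLM (n := Fin n) (𝕜 := ℝ) A v) = v.ofLp ⬝ᵥ (A *ᵥ v.ofLp) := by
  rw [EuclideanSpace.inner_eq_star_dotProduct, Matrix.ofLp_toEuclideanCLM, star_trivial,
    dotProduct_comm]

theorem inner_toEuclideanCLM_pos {n : ℕ} {A : Matrix (Fin n) (Fin n) ℝ} (hA : A.PosDef)
    {v : Vec n} (hv : v ≠ 0) :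
    0 < inner ℝ v (Matrix.toEuclideanCLM (n := Fin n) (𝕜 := ℝ) A v) := by
  rw [inner_toEuclideanCLM]
  simpa using hA.dotProduct_mulVec_pos (x := v.ofLp) (by simpa using hv)

/-- A quadratic form sees only the symmetric part, which turns the definiteness assumption on g into
a sign for ⟨v, g v⟩. -/
theorem inner_toEuclideanCLM_symPart {n : ℕ} (A : Matrix (Fin n) (Fin n) ℝ) (v : Vec n) :
    inner ℝ v (Matrix.toEuclideanCLM (n := Fin n) (𝕜 := ℝ) (symPart A) v)
      = inner ℝ v (Matrix.toEuclideanCLM (n := Fin n) (𝕜 := ℝ) A v) := by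
  have h : v.ofLp ⬝ᵥ (Aᵀ *ᵥ v.ofLp) = v.ofLp ⬝ᵥ (A *ᵥ v.ofLp) := by
    rw [Matrix.mulVec_transpose, dotProduct_comm, Matrix.dotProduct_mulVec]
  rw [inner_toEuclideanCLM, inner_toEuclideanCLM, symPart, Matrix.smul_mulVec, dotProduct_smul,
    Matrix.add_mulVec, dotProduct_add, h, smul_eq_mul]
  ring

namespace Design

variable {n p N : ℕ} (D : Design n p N)

theorem isClosed_feasibleInputs (z : Vec n) (t : ℝ) : IsClosed (D.feasibleInputs z t) := by
  have hv : Continuous fun u => D.virtualField z u :=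
    continuous_const.add (LinearMap.continuous_of_finiteDimensional _)
  simp only [feasibleInputs, ofPred_forall]
  exact isClosed_iInter fun j => isClosed_le continuous_const
    ((((ContinuousLinearMap.continuous _).comp hv).add continuous_const).add continuous_const)

theorem cost_eq (u : Vec p) :
    D.cost u = 1 / 2 * inner ℝ u (Matrix.toEuclideanCLM (n := Fin p) (𝕜 := ℝ) D.H u)
      + inner ℝ (WithLp.toLp 2 D.F) u := by
  rw [inner_toEuclideanCLM, EuclideanSpace.inner_eq_star_dotProduct, star_trivial, cost,
    dotProduct_comm D.F]

/-- The cost is continuous and coercive because H is positive definite, and the feasible set is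
closed. This guarantees that the virtual control is a genuine feasible input rather than the default
0. -/
theorem exists_isOptimal (hH : D.H.PosDef) {z : Vec n} {t : ℝ}
    (hne : (D.feasibleInputs z t).Nonempty) : ∃ u, D.IsOptimal z t u := by
  obtain ⟨u₀, hu₀⟩ := hne
  set F : Vec p := WithLp.toLp 2 D.F with hF
  obtain ⟨l, hl, hle⟩ := exists_pos_mul_sq_le_inner (E := Vec p) (k := 1)
    (G := fun _ => Matrix.toEuclideanCLM (n := Fin p) (𝕜 := ℝ) D.H) continuous_const
    (fun _ v hv => by simpa using inner_toEuclideanCLM_pos hH hv) (isCompact_singleton (x := 0))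
  have hcont : Continuous D.cost := by
    simp only [funext D.cost_eq]
    exact (continuous_const.mul (continuous_id.inner (ContinuousLinearMap.continuous _))).add
      (continuous_const.inner continuous_id)
  obtain ⟨u, hu, hmin⟩ := hcont.continuousOn.exists_isMinOn' (D.isClosed_feasibleInputs z t) hu₀
    (by
      refine Eventually.filter_mono inf_le_left ?_
      -- For such u, (l/2) ‖u‖² - ‖F‖ ‖u‖ ≥ |cost u₀| ‖u‖ ≥ cost u₀, so no point outside a compact
      -- set beats u₀.
      filter_upwards [(tendsto_norm_cocompact_atTop (E := Vec p)).eventually_ge_atTop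
        (max 1 ((‖F‖ + |D.cost u₀|) / (l / 2)))] with u hu
      have h1 : 1 ≤ ‖u‖ := (le_max_left _ _).trans hu
      have h2 : ‖F‖ + |D.cost u₀| ≤ ‖u‖ * (l / 2) :=
        (div_le_iff₀ (by positivity)).1 ((le_max_right _ _).trans hu)
      have h3 := hle 0 rfl u
      have h4 := neg_le_of_abs_le (abs_real_inner_le_norm F u)
      have h5 := mul_le_mul_of_nonneg_right h2 (norm_nonneg u)
      have h6 := mul_le_mul_of_nonneg_left h1 (abs_nonneg (D.cost u₀))
      have h7 := le_abs_self (D.cost u₀)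
      rw [D.cost_eq u]
      nlinarith)
  exact ⟨u, hu, hmin⟩

theorem virtualControl_mem (hH : D.H.PosDef) {z : Vec n} {t : ℝ}
    (hne : (D.feasibleInputs z t).Nonempty) : D.virtualControl z t ∈ D.feasibleInputs z t := by
  have h := D.exists_isOptimal hH hne
  rw [virtualControl, dif_pos h]
  exact h.choose_spec.1

theorem barrier_castSucc (i : Fin N) (z : Vec n) (t : ℝ) :
    D.barrier i.castSucc z t = ‖z - D.bu i t‖ ^ 2 - (D.ru i + D.rc) ^ 2 := by
  simp [barrier]

theorem barrier_last (z : Vec n) (t : ℝ) :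
    D.barrier (Fin.last N) z t = D.shrinkRadius t ^ 2 - ‖z - D.bR‖ ^ 2 := by
  simp [barrier]

theorem differentiable_shrinkRadius : Differentiable ℝ D.shrinkRadius := by
  unfold shrinkRadius
  fun_prop

theorem continuousOn_barrier {I : Set ℝ} {c : ℝ → Vec n} (hc : ContinuousOn c I)
    (hb : ∀ j, DifferentiableOn ℝ (D.bu j) I) (j : Fin (N + 1)) :
    ContinuousOn (fun t => D.barrier j (c t) t) I := by
  induction j using Fin.lastCases with
  | last =>
    simp only [barrier_last]
    exact (D.differentiable_shrinkRadius.continuous.continuousOn.pow 2).sub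
      ((hc.sub continuousOn_const).norm.pow 2)
  | cast i =>
    simp only [barrier_castSucc]
    exact ((hc.sub (hb i).continuousOn).norm.pow 2).sub continuousOn_const

/-- Chain rule for the barriers along a curve. -/
theorem hasDerivAt_barrier {a b t : ℝ} {c : ℝ → Vec n} {v : Vec n} (hc : HasDerivAt c v t)
    (ht : t ∈ Ioo a b) (hb : ∀ j, DifferentiableOn ℝ (D.bu j) (Icc a b)) (j : Fin (N + 1)) :
    HasDerivAt (fun s => D.barrier j (c s) s)
      (fderiv ℝ (fun y => D.barrier j y t) (c t) v
        + derivWithin (fun s => D.barrier j (c t) s) (Icc a b) t) t := by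
  have hmem : Icc a b ∈ 𝓝 t := Icc_mem_nhds ht.1 ht.2
  rw [derivWithin_of_mem_nhds hmem]
  have hsq : ∀ b₀ : Vec n, fderiv ℝ (fun y => ‖y - b₀‖ ^ 2) (c t) v
      = 2 * inner ℝ (c t - b₀) v := fun b₀ => by
    have h := ((hasFDerivAt_id (𝕜 := ℝ) (c t)).sub_const b₀).norm_sq
    have h' : HasFDerivAt (fun y : Vec n => ‖y - b₀‖ ^ 2) _ (c t) := h
    rw [h'.fderiv]
    simp [inner_sub_left]
  induction j using Fin.lastCases with
  | last =>
    simp only [barrier_last]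
    have hr := ((D.differentiable_shrinkRadius t).hasDerivAt.pow 2)
    rw [fderiv_const_sub, neg_apply, hsq, deriv_sub_const]
    have h := hr.sub (hc.sub_const D.bR).norm_sq
    have hr' : deriv (fun s => D.shrinkRadius s ^ 2) t = _ := hr.deriv
    rw [hr', neg_add_eq_sub]
    exact h
  | cast i =>
    simp only [barrier_castSucc]
    have hbi := ((hb i).differentiableAt hmem).hasDerivAt
    rw [fderiv_sub_const, hsq, deriv_sub_const]
    have h1 : deriv (fun s => ‖c t - D.bu i s‖ ^ 2) t = _ := (hbi.const_sub (c t)).norm_sq.deriv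
    rw [h1]
    have h := (hc.sub hbi).norm_sq.sub_const ((D.ru i + D.rc) ^ 2)
    convert! h using 1
    rw [Pi.sub_apply, inner_sub_right, inner_neg_right]
    ring

/-- The barriers stay nonnegative along the virtual trajectory. -/
theorem barrier_nonneg {c : ℝ → Vec n} (hD : D.Admissible (c 0))
    (hc₀ : Metric.ball (c 0) D.rc ⊆ (D.unsafeSet 0)ᶜ) (hc : D.IsVirtualTrajectory c)
    (hfeas : ∀ t ∈ Icc 0 D.tf, (D.feasibleInputs (c t) t).Nonempty) (j : Fin (N + 1)) :
    ∀ t ∈ Icc 0 D.tf, 0 ≤ D.barrier j (c t) t := by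
  obtain ⟨hcont, S, hS, -⟩ := hc
  refine nonneg_of_neg_comp_le_deriv_off_finset S (γ := D.γ j)
    (D.continuousOn_barrier hcont hD.bu_differentiable j) ?_
    (fun t ht htS => D.hasDerivAt_barrier
      ((hS t (Ioo_subset_Icc_self ht) htS).hasDerivAt (Icc_mem_nhds ht.1 ht.2)) ht
      hD.bu_differentiable j)
    (fun s hs => ?_) (fun t ht htS => ?_)
  · induction j using Fin.lastCases with
    | last =>
      rw [barrier_last, sub_nonneg]
      exact pow_le_pow_left₀ (norm_nonneg _) hD.start_le 2
    | cast i =>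
      -- Disjointness of open balls with positive radii amounts to a distance of at least r_j + r_c
      -- between the centers, that is, h_j ≥ 0 at time 0.
      have hdisj : Disjoint (Metric.ball (c 0) D.rc) (Metric.ball (D.bu i 0) (D.ru i)) := by
        refine disjoint_left.2 fun z hz hz' => hc₀ hz ?_
        exact mem_iUnion.2 ⟨i, hz'⟩
      rw [disjoint_ball_ball_iff hD.rc_pos (hD.ru_pos i), dist_eq_norm] at hdisj
      rw [barrier_castSucc, sub_nonneg, add_comm]
      exact pow_le_pow_left₀ (add_pos hD.rc_pos (hD.ru_pos i)).le hdisj 2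
  · exact ((hD.γ_class j).strictMono hs).le.trans_eq (hD.γ_class j).map_zero
  · exact D.virtualControl_mem hD.H_posDef (hfeas t (Ioo_subset_Icc_self ht)) j

/-- A curve confined to a zone along which the barriers are nonnegative meets the task. -/
theorem reachAvoid_of_confined {c x : ℝ → Vec n} (hD : D.Admissible (c 0))
    (hbar : ∀ j, ∀ t ∈ Icc 0 D.tf, 0 ≤ D.barrier j (c t) t)
    (hx : ∀ t ∈ Icc 0 D.tf, ‖x t - c t‖ < D.rc) : D.ReachAvoid x := by
  refine ⟨fun t ht hmem => ?_, ?_⟩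
  · obtain ⟨i, hi⟩ := mem_iUnion.1 hmem
    rw [mem_ball_iff_norm] at hi
    have h1 := hbar i.castSucc t ht
    rw [barrier_castSucc, sub_nonneg] at h1
    have h2 : D.ru i + D.rc ≤ ‖c t - D.bu i t‖ := le_of_abs_le
      (abs_le_of_sq_le_sq h1 (norm_nonneg _))
    have h3 := norm_sub_le_norm_sub_add_norm_sub (c t) (x t) (D.bu i t)
    rw [norm_sub_rev (c t) (x t)] at h3
    linarith [hx t ht]
  · have ht : D.tf ∈ Icc 0 D.tf := right_mem_Icc.2 hD.tf_pos.le
    have h1 := hbar (Fin.last N) _ ht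
    rw [barrier_last, sub_nonneg] at h1
    -- The barrier only compares squares; the sign of the shrinking radius at t_f is what permits
    -- taking roots.
    have h2 : ‖c D.tf - D.bR‖ ≤ D.shrinkRadius D.tf := le_of_abs_le
      (abs_le_of_sq_le_sq h1 hD.final_nonneg)
    have h3 := norm_sub_le_norm_sub_add_norm_sub (x D.tf) (c D.tf) D.bR
    rw [target, mem_closedBall_iff_norm]
    linarith [hx _ ht, hD.final_le]

/-- A virtual trajectory is Lipschitz from the left at every time. -/
theorem IsVirtualTrajectory.exists_left_lipschitz {D : Design n p N} {c : ℝ → Vec n}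
    (hc : D.IsVirtualTrajectory c) {T : ℝ} (hT : T ∈ Ioc 0 D.tf) :
    ∃ L, ∀ᶠ t in 𝓝[<] T, ‖c t - c T‖ ≤ L * (T - t) := by
  obtain ⟨-, S, hS, hS'⟩ := hc
  have hT' := Ioc_subset_Icc_self hT
  -- A left derivative at T exists in both cases, also at a switching time. The resulting L depends
  -- on T.
  obtain ⟨v, hv⟩ : ∃ v, HasDerivWithinAt c v (Icc 0 T) T := by
    by_cases h : T ∈ S
    · exact (hS' T hT' h).1
    · exact ⟨_, (hS T hT' h).mono (Icc_subset_Icc_right hT.2)⟩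
  obtain ⟨L, hL⟩ := hv.hasFDerivWithinAt.isBigO_sub.bound
  refine ⟨L, ?_⟩
  rw [← nhdsWithin_Ico_eq_nhdsLT hT.1]
  filter_upwards [hL.filter_mono (nhdsWithin_mono _ Ico_subset_Icc_self), self_mem_nhdsWithin]
    with t ht htT
  rwa [norm_sub_rev t, Real.norm_of_nonneg (sub_nonneg.2 htT.2.le)] at ht

end Design

/-! ### The plant -/

section Plant

variable {n : ℕ} {f : Vec n → Vec n} {g : Vec n → Matrix (Fin n) (Fin n) ℝ} {ω : ℝ → Vec n}

theorem PlantAssumption.exists_regularPlant (hP : PlantAssumption f g ω) {τ : ℝ} (hτ : 0 < τ) :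
    ∃ S B, RegularPlant f (fun x => Matrix.toEuclideanCLM (n := Fin n) (𝕜 := ℝ) (g x)) ω S τ B := by
  obtain ⟨Bf, hBf⟩ := hP.f_bounded
  obtain ⟨Bg, hBg⟩ := hP.g_bounded
  obtain ⟨Bω, hBω⟩ := hP.ω_bounded
  obtain ⟨S, hS, -, -⟩ := hP.ω_piecewise τ hτ
  refine ⟨S, max Bf (max Bg Bω), hP.f_lipschitz, fun x => (hBf x).trans (le_max_left _ _), ?_,
    fun x => ?_, fun t ht => (hBω t ht.1).trans ((le_max_right _ _).trans (le_max_right _ _)),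
    fun t ht htS => (hS t (Ioo_subset_Icc_self ht) htS).continuousAt (Icc_mem_nhds ht.1 ht.2)⟩
  -- The matrix norm in force is the operator norm, so passing to operators is isometric and
  -- preserves local Lipschitz continuity.
  · have hiso : LipschitzWith 1
        (Matrix.toEuclideanCLM (n := Fin n) (𝕜 := ℝ) : Matrix (Fin n) (Fin n) ℝ → _) :=
      LipschitzWith.of_dist_le_mul fun A A' => by
        rw [dist_eq_norm, dist_eq_norm, ← map_sub, Matrix.l2_opNorm_toEuclideanCLM]
        simp
    exact hiso.locallyLipschitz.comp hP.g_lipschitz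
  · rw [Matrix.l2_opNorm_toEuclideanCLM]
    exact (hBg x).trans ((le_max_left _ _).trans (le_max_right _ _))

theorem PlantAssumption.gain_inner_pos (hP : PlantAssumption f g ω) {k : ℝ} (hk : GainSign g k)
    (x v : Vec n) (hv : v ≠ 0) :
    0 < k * inner ℝ v (Matrix.toEuclideanCLM (n := Fin n) (𝕜 := ℝ) (g x) v) := by
  rw [← inner_toEuclideanCLM_symPart]
  rcases hP.g_sign_definite x with h | h
  · exact mul_pos (hk.1 x h) (inner_toEuclideanCLM_pos h hv)
  · have h1 := inner_toEuclideanCLM_pos h hv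
    rw [map_neg, neg_apply, inner_neg_right] at h1
    exact mul_pos_of_neg_of_neg (hk.2 x h) (by linarith)

theorem loopField_toEuclideanCLM (k rc : ℝ) (c : ℝ → Vec n) (t : ℝ) (x : Vec n) :
    loopField f (fun x => Matrix.toEuclideanCLM (n := Fin n) (𝕜 := ℝ) (g x)) ω k rc c zeta t x
      = f x + Matrix.toEuclideanLin (g x) (confinementLaw k rc (x - c t)) + ω t := by
  rw [confinementLaw_eq]
  rfl

theorem SolvesOff.isClosedLoopSolution {k rc τ : ℝ} {c x : ℝ → Vec n} {S : Finset ℝ}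
    (hx : SolvesOff S (loopField f (fun x => Matrix.toEuclideanCLM (n := Fin n) (𝕜 := ℝ) (g x)) ω
      k rc c zeta) 0 τ x) : IsClosedLoopSolution f g ω k rc c (Icc 0 τ) x := by
  -- The end points join the exceptional set, since `SolvesOff` gives the equation only in the
  -- interior.
  refine ⟨hx.1, insert 0 (insert τ S), fun t ht htS => ?_⟩
  simp only [Finset.mem_insert, not_or] at htS
  rw [← loopField_toEuclideanCLM]
  exact (hx.2 t ⟨lt_of_le_of_ne ht.1 (Ne.symm htS.1), lt_of_le_of_ne ht.2 htS.2.1⟩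
    htS.2.2).hasDerivWithinAt

theorem IsClosedLoopSolution.exists_solvesOff {k rc T : ℝ} {c y : ℝ → Vec n}
    (hy : IsClosedLoopSolution f g ω k rc c (Ico 0 T) y) :
    ∃ S, ∀ b < T, SolvesOff S (loopField f
      (fun x => Matrix.toEuclideanCLM (n := Fin n) (𝕜 := ℝ) (g x)) ω k rc c zeta) 0 b y := by
  obtain ⟨hc, S, hS⟩ := hy
  refine ⟨S, fun b hb => ⟨hc.mono fun t ht => ⟨ht.1, ht.2.trans_lt hb⟩, fun t ht htS => ?_⟩⟩
  rw [loopField_toEuclideanCLM]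
  exact (hS t ⟨ht.1.le, ht.2.trans hb⟩ htS).hasDerivAt (Ico_mem_nhds ht.1 (ht.2.trans hb))

end Plant

end VCZ

/-! ### Assembly of the main theorem -/

theorem mainTheorem1 {n p N : ℕ}
    (f : VCZ.Vec n → VCZ.Vec n) (g : VCZ.Vec n → Matrix (Fin n) (Fin n) ℝ) (ω : ℝ → VCZ.Vec n)
    (hplant : VCZ.PlantAssumption f g ω)
    (k : ℝ) (hk : VCZ.GainSign g k)
    (D : VCZ.Design n p N) (c : ℝ → VCZ.Vec n) (hD : D.Admissible (c 0))
    (x₀ : VCZ.Vec n) (hx₀ : x₀ ∈ Metric.ball (c 0) D.rc)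
    (hc₀ : Metric.ball (c 0) D.rc ⊆ (D.unsafeSet 0)ᶜ)
    (hc : D.IsVirtualTrajectory c)
    (hfeas : ∀ t ∈ Set.Icc 0 D.tf, (D.feasibleInputs (c t) t).Nonempty) :
    ∃ x : ℝ → VCZ.Vec n,
      x 0 = x₀ ∧
      VCZ.IsClosedLoopSolution f g ω k D.rc c (Set.Icc 0 D.tf) x ∧
      (∀ t ∈ Set.Icc 0 D.tf, x t ∈ Metric.ball (c t) D.rc) ∧
      D.ReachAvoid x ∧
      (∀ T : ℝ, 0 < T → T ≤ D.tf → ∀ y : ℝ → VCZ.Vec n, y 0 = x₀ →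
        VCZ.IsClosedLoopSolution f g ω k D.rc c (Set.Ico 0 T) y →
        Set.EqOn y x (Set.Ico 0 T)) := by
  obtain ⟨S, B, hP⟩ := hplant.exists_regularPlant hD.tf_pos
  obtain ⟨x, hx0, hx, hconf⟩ := hP.exists_confined hD.tf_pos hc.1 hD.rc_pos
    (hplant.gain_inner_pos hk) (fun T hT => hc.exists_left_lipschitz hT)
    (mem_ball_iff_norm.1 hx₀)
  refine ⟨x, hx0, hx.isClosedLoopSolution, fun t ht => mem_ball_iff_norm.2 (hconf t ht),
    D.reachAvoid_of_confined hD (D.barrier_nonneg hD hc₀ hc hfeas) hconf,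
    fun T _ hT y hy0 hy t ht => ?_⟩
  obtain ⟨S', hS'⟩ := hy.exists_solvesOff
  have htf : t ≤ D.tf := ht.2.le.trans hT
  exact hP.eqOn_of_confined hD.rc_pos ht.1 (hc.1.mono (Icc_subset_Icc_right htf))
    (hx.mono Finset.subset_union_left le_rfl htf)
    (fun s hs => hconf s ⟨hs.1, hs.2.trans htf⟩)
    ((hS' t ht.2).mono (Finset.subset_union_right (s₁ := S)) le_rfl le_rfl)
    (hy0.trans hx0.symm) ⟨ht.1, le_rfl⟩
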